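/- Let $\mathbb K=\mathbb R$ or $\mathbb C$. An F-sequence space over $\mathbb Z$ is a linear subspace $E$ of $\mathbb K^{\mathbb Z}$ with a complete metrizable vector space topology for which convergence in $E$ implies coordinatewise convergence. Let $E$ be a locally bounded or locally convex F-sequence space over $\mathbb Z$ that contains the canonical unit sequences $e_n$, $n\in\mathbb Z$, and in which $\operatorname{span}\{e_n\mid n\in\mathbb Z\}$ is dense. Let $T:E\to E$ be a bilateral weighted shift with nonzero weights $(w_n)_{n\in\mathbb Z}$, that is, a continuous linear operator with $T(e_n)=w_ne_{n-1}$ for all $n\in\mathbb Z$. Put $\beta_0:=1$, $\beta_n:=w_1\cdots w_n$ for $n\ge 1$, and $\beta_n:=\big(\prod_{k=n+1}^{0}w_k\big)^{-1}$ for $n\le -1$. A random variable or random vector $Y$ has full support if $P(Y\in U)>0$ for every nonempty open set $U$. A vector $x$ is frequently hypercyclic for $T$ if, for every nonempty open $U\subseteq E$, the set $A=\{n\ge 0\mid T^nx\in U\}$ has positive lower density, i.e. $\liminf_{N\to\infty}\frac{1}{N+1}\#(A\cap[0,N])>0$. A Borel probability measure $\mu$ on $E$ is strongly mixing for $T$ if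 it is $T$-invariant and $\mu(A\cap T^{-n}B)\to\mu(A)\mu(B)$ for all Borel sets $A,B$. A scalar random variable $X$ is subgaussian if there are $C,c>0$ with $P(|X|\ge t)\le Ce^{-ct^2}$ for all $t\ge 0$. Say that a $\mathbb K$-valued random variable $X$ is *admissible* if, for every sequence $(X_n)_{n\in\mathbb Z}$ of independent copies of $X$, the series $v=\sum_{n\in\mathbb Z}\frac{X_n}{\beta_n}e_n$ almost surely converges unconditionally in $E$, $v$ is almost surely frequently hypercyclic for $T$, and the distribution of $v$ is a strongly mixing measure with full support for $T$. (i) If the series $\sum_{n\in\mathbb Z}\frac{e_n}{\beta_n}$ converges unconditionally in $E$, then there exists an admissible random variable $X$ with full support. (ii) If the series $\sum_{n\in\mathbb Z\setminus\{0\}}\frac{\sqrt{\log|n|}}{\beta_n}e_n$ converges unconditionally in $E$, then every subgaussian random variable $X$ with full support is admissible. In particular, every non-constant Gaussian variable $X$ is admissible (not necessarily centered; when $\mathbb K=\mathbb C$, this means that $(\operatorname{Re}X,\operatorname{Im}X)$ is jointly Gaussian and not concentrated on a real affine line of $\mathbb C$). -/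

import Mathlib

open MeasureTheory ProbabilityTheory Filter Topology

noncomputable section

/-- The numbers `β n` attached to a weight sequence `w` over `ℤ`:
`β n = w 1 * ⋯ * w n` for `n ≥ 0` (so `β 0 = 1`) and
`β n = (w (n + 1) * ⋯ * w 0)⁻¹` for `n ≤ -1`. -/
def bilateralBeta {𝕜 : Type*} [RCLike 𝕜] (w : ℤ → 𝕜) (n : ℤ) : 𝕜 :=
  if 0 ≤ n then ∏ k ∈ Finset.Icc 1 n, w k else (∏ k ∈ Finset.Icc (n + 1) 0, w k)⁻¹

/-- Some neighbourhood of zero is (von Neumann) bounded. -/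
def IsLocallyBoundedTVS (𝕜 : Type*) (E : Type*) [RCLike 𝕜] [AddCommGroup E] [Module 𝕜 E]
    [TopologicalSpace E] : Prop :=
  ∃ U ∈ 𝓝 (0 : E), Bornology.IsVonNBounded 𝕜 U

/-- The lower density `liminf_N #{n ∈ A : n ≤ N} / (N + 1)` of a set of natural numbers. -/
def lowerDensity (A : Set ℕ) : ℝ :=
  liminf (fun N : ℕ => ((A ∩ Set.Iic N).ncard : ℝ) / ((N : ℝ) + 1)) atTop

/-- The vector `x` is frequently hypercyclic for `T`: its orbit visits every non-empty open set
along a set of times of positive lower density. -/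
def IsFrequentlyHypercyclic {E : Type*} [TopologicalSpace E] (T : E → E) (x : E) : Prop :=
  ∀ U : Set E, IsOpen U → U.Nonempty → 0 < lowerDensity {n : ℕ | T^[n] x ∈ U}

/-- The measure `μ` is invariant and strongly mixing for `T`. -/
def IsStronglyMixing {E : Type*} [MeasurableSpace E] (T : E → E) (μ : Measure E) : Prop :=
  MeasurePreserving T μ μ ∧
    ∀ A B : Set E, MeasurableSet A → MeasurableSet B →
      Tendsto (fun n : ℕ => μ (A ∩ T^[n] ⁻¹' B)) atTop (𝓝 (μ A * μ B))

/-- The random variable `X` has full support: it takes values in every non-empty open set with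
positive probability. -/
def HasFullSupport {Ω F : Type*} [MeasurableSpace Ω] [TopologicalSpace F] [MeasurableSpace F]
    (X : Ω → F) (P : Measure Ω) : Prop :=
  AEMeasurable X P ∧ (P.map X).IsOpenPosMeasure

/-- The scalar random variable `X` is subgaussian: `P (|X| ≥ t) ≤ C exp (-c t ^ 2)` for all
`t ≥ 0`, with constants `C, c > 0`. The variable need not be centered. -/
def IsSubgaussian {Ω 𝕜 : Type*} [RCLike 𝕜] [MeasurableSpace Ω] (X : Ω → 𝕜) (P : Measure Ω) :
    Prop :=
  AEMeasurable X P ∧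
    ∃ C c : ℝ, 0 < C ∧ 0 < c ∧
      ∀ t : ℝ, 0 ≤ t → P.real {ω | t ≤ ‖X ω‖} ≤ C * Real.exp (-c * t ^ 2)

/-- The scalar random variable `X` is Gaussian (not necessarily centered) and no non-zero real
linear functional of it is almost surely constant. For real scalars this means that `X` is a
non-constant Gaussian variable; for complex scalars, that `(Re X, Im X)` is jointly Gaussian and
not concentrated on a real line, which holds in particular when `Re X` and `Im X` are independent
non-constant Gaussian variables. -/
def IsNonconstantGaussian {Ω 𝕜 : Type*} [RCLike 𝕜] [MeasurableSpace Ω] (X : Ω → 𝕜)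
    (P : Measure Ω) : Prop :=
  HasGaussianLaw X P ∧
    ∀ L : 𝕜 →L[ℝ] ℝ, L ≠ 0 → ¬ ∃ a : ℝ, ∀ᵐ ω ∂P, L (X ω) = a

/-- `Y` is a sequence (over `ℤ`) of independent copies of the random variable `X`. -/
def IsIIDCopies {Ω Ω₀ F : Type*} [MeasurableSpace Ω] [MeasurableSpace Ω₀] [MeasurableSpace F]
    (Y : ℤ → Ω → F) (P : Measure Ω) (X : Ω₀ → F) (P₀ : Measure Ω₀) : Prop :=
  iIndepFun Y P ∧ ∀ n, IdentDistrib (Y n) X P P₀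

/-- The random vector `v = ∑ Y n • u n` is almost surely well-defined (the series converges
unconditionally) and frequently hypercyclic for `T`, and its distribution is a strongly mixing
measure of full support for `T`. -/
structure InducesMixingFHC {𝕜 E Ω : Type*} [RCLike 𝕜] [AddCommGroup E] [Module 𝕜 E]
    [TopologicalSpace E] [MeasurableSpace E] [MeasurableSpace Ω]
    (T : E → E) (u : ℤ → E) (Y : ℤ → Ω → 𝕜) (P : Measure Ω) : Prop where
  wellDefined : ∀ᵐ ω ∂P, Summable fun n : ℤ => Y n ω • u n
  aemeasurable : AEMeasurable (fun ω => ∑' n : ℤ, Y n ω • u n) P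
  frequentlyHypercyclic : ∀ᵐ ω ∂P, IsFrequentlyHypercyclic T (∑' n : ℤ, Y n ω • u n)
  stronglyMixing : IsStronglyMixing T (P.map fun ω => ∑' n : ℤ, Y n ω • u n)
  fullSupport : HasFullSupport (fun ω => ∑' n : ℤ, Y n ω • u n) P

end

/-! Put `u n = e n / β n`. Then `T (u n) = u (n - 1)`, so `y ↦ ∑ y n • u n` intertwines the left
shift on two-sided scalar sequences with `T`. Independent copies of `X` have a product law, for
which the left shift is strongly mixing, and the image of this law is strongly mixing for `T`
(`IsStronglyMixing.of_semiconj`).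

Convergence rests on bounded multipliers: if `∑ R n • u n` converges unconditionally and `‖y n‖ ≤ R
n` for all but finitely many `n`, then `∑ y n • u n` converges unconditionally. This is where local
boundedness or local convexity enters. By Borel–Cantelli, `∑ P (‖X‖ > R n) < ∞` suffices. Full
support follows since a finite head can approximate any finite combination of the `u n` while,
independently and with positive probability, the tail stays small. Frequent hypercyclicity follows
from the zero-one law for invariant sets and the maximal ergodic inequality, applied along a
countable base (`IsStronglyMixing.ae_isFrequentlyHypercyclic`).

It remains to find `R`. In (i), a summable family can absorb some factor `R n → ∞`, and a discrete
`X` is built with tails summable along `R`. In (ii), `R n = M √(log |n|)` with `M` large turns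
subgaussian tails into `O(1 / n ^ 2)`; Gaussian variables are subgaussian by Fernique's theorem. -/

/-! ### Bounded multipliers -/

section RealMultipliers

open scoped Pointwise

variable {ι E : Type*} [AddCommGroup E] [Module ℝ E]

/-- Each coefficient interpolates between including and omitting its vector, so the sum is a convex
combination of subsums. The base point `c` collects the vectors already included in the induction.
-/
theorem Convex.add_sum_smul_mem {W : Set E} (hW : Convex ℝ W) (x : ι → E) (a : ι → ℝ)
    (ha : ∀ i, 0 ≤ a i) (ha' : ∀ i, a i ≤ 1) (F : Finset ι) :
    ∀ c : E, (∀ G ⊆ F, c + ∑ i ∈ G, x i ∈ W) → c + ∑ i ∈ F, a i • x i ∈ W := by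
  classical
  induction F using Finset.induction_on with
  | empty => intro c h; simpa using h ∅ (by simp)
  | insert i F hi ih =>
    intro c h
    have h1 : (c + x i) + ∑ j ∈ F, a j • x j ∈ W := by
      refine ih _ fun G hG => ?_
      have := h (insert i G) (Finset.insert_subset_insert _ hG)
      rwa [Finset.sum_insert (fun hh => hi (hG hh)), ← add_assoc] at this
    have h2 : c + ∑ j ∈ F, a j • x j ∈ W :=
      ih _ fun G hG => h G (hG.trans (Finset.subset_insert _ _))
    have := hW h1 h2 (ha i) (sub_nonneg.2 (ha' i)) (by ring)
    rw [Finset.sum_insert hi]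
    convert this using 1
    module

/-- A real number in `[0, 1]` is `b⁻¹` times the number of its layers plus a remainder. -/
theorem eq_inv_mul_sum_layers_add (b : ℕ) (hb : 0 < b) {a : ℝ} (ha : 0 ≤ a) (ha' : a ≤ 1) :
    a = (b : ℝ)⁻¹ * (∑ k ∈ Finset.range b, if (k : ℝ) + 1 ≤ b * a then 1 else 0)
      + (b : ℝ)⁻¹ * Int.fract (b * a) := by
  have hb' : (0 : ℝ) < b := by exact_mod_cast hb
  have h1 : (∑ k ∈ Finset.range b, if (k : ℝ) + 1 ≤ b * a then (1 : ℝ) else 0) = ⌊b * a⌋₊ := by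
    rw [Finset.sum_boole]
    congr 1
    have : (Finset.range b).filter (fun k : ℕ => (k : ℝ) + 1 ≤ b * a)
        = Finset.range ⌊b * a⌋₊ := by
      ext k
      simp only [Finset.mem_filter, Finset.mem_range]
      have h2 : (k : ℝ) + 1 ≤ b * a ↔ k < ⌊b * a⌋₊ := by
        rw [← Nat.succ_le_iff, Nat.le_floor_iff (by positivity)]
        push_cast; rfl
      rw [h2, and_iff_right_iff_imp]
      intro hk
      have : (⌊b * a⌋₊ : ℝ) ≤ b := (Nat.floor_le (by positivity)).trans (by nlinarith)
      exact hk.trans_le (by exact_mod_cast this)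
    rw [this, Finset.card_range]
  rw [h1, ← mul_add, natCast_floor_eq_intCast_floor (by positivity), Int.floor_add_fract]
  field_simp

/-- Layer-cake decomposition at resolution `1 / b`. The remainder is again a sum with coefficients
in `[0, 1]`, now carrying a factor `1 / b`; this self-similarity drives the bootstrap for locally
bounded spaces. -/
theorem sum_smul_eq_inv_smul_sum_layers_add (b : ℕ) (hb : 0 < b) (x : ι → E) (a : ι → ℝ)
    (ha : ∀ i, 0 ≤ a i) (ha' : ∀ i, a i ≤ 1) (F : Finset ι) :
    ∑ i ∈ F, a i • x i =
      (b : ℝ)⁻¹ • (∑ k ∈ Finset.range b, ∑ i ∈ F with (k : ℝ) + 1 ≤ b * a i, x i)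
      + (b : ℝ)⁻¹ • ∑ i ∈ F, Int.fract (b * a i) • x i := by
  simp_rw [Finset.sum_filter]
  rw [Finset.sum_comm, Finset.smul_sum, Finset.smul_sum, ← Finset.sum_add_distrib]
  refine Finset.sum_congr rfl fun i _ => ?_
  conv_lhs => rw [eq_inv_mul_sum_layers_add b hb (ha i) (ha' i)]
  rw [add_smul, mul_smul, mul_smul, Finset.sum_smul]
  congr 2
  refine Finset.sum_congr rfl fun k _ => ?_
  split_ifs <;> simp

variable [TopologicalSpace E]

variable (ι E) in
/-- Finite sums `∑ a i • x i` with coefficients in `[0, 1]` are uniformly small as soon as all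
subsums of `∑ x i` are small. -/
def HasUnitIntervalMultipliers : Prop :=
  ∀ W ∈ 𝓝 (0 : E), ∃ V ∈ 𝓝 (0 : E), ∀ (x : ι → E) (a : ι → ℝ) (F : Finset ι),
    (∀ i, 0 ≤ a i) → (∀ i, a i ≤ 1) → (∀ G ⊆ F, ∑ i ∈ G, x i ∈ V) → ∑ i ∈ F, a i • x i ∈ W

theorem hasUnitIntervalMultipliers_of_locallyConvexSpace [IsTopologicalAddGroup E]
    [ContinuousSMul ℝ E] [LocallyConvexSpace ℝ E] : HasUnitIntervalMultipliers ι E := by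
  intro W hW
  obtain ⟨V, ⟨hV, hVc⟩, hVW⟩ := (LocallyConvexSpace.convex_basis_zero ℝ E).mem_iff.1 hW
  refine ⟨V, hV, fun x a F ha ha' h => hVW ?_⟩
  have := hVc.add_sum_smul_mem x a ha ha' F 0 (fun G hG => by simpa using h G hG)
  simpa using this

/-- A bounded balanced `U` with `U + U ⊆ c • U` acts as the unit ball of a quasi-norm. A crude bound
`K`, depending on the family, holds for all coefficients at once; splitting into layers and a
remainder halves it as long as `K ≥ b`. Iterating leaves the bound `b`, which does not depend on the
number of terms. -/
theorem hasUnitIntervalMultipliers_of_isVonNBounded [IsTopologicalAddGroup E]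
    [ContinuousSMul ℝ E] {U : Set E} (hU : U ∈ 𝓝 0) (hUb : Bornology.IsVonNBounded ℝ U) :
    HasUnitIntervalMultipliers ι E := by
  classical
  wlog hbal : Balanced ℝ U generalizing U
  · exact this (balancedCore_mem_nhds_zero hU) (hUb.subset (balancedCore_subset U))
      (balancedCore_balanced U)
  -- the scale of dilations of `U`
  have hmono : ∀ {s t : ℝ} {x : E}, 0 ≤ s → s ≤ t → x ∈ s • U → x ∈ t • U := by
    intro s t x hs hst hx
    refine hbal.smul_mono ?_ hx
    rw [Real.norm_of_nonneg hs, Real.norm_of_nonneg (hs.trans hst)]; exact hst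
  have hscale : ∀ (r : ℝ) {s : ℝ} {x : E}, x ∈ s • U → r • x ∈ (r * s) • U := by
    intro r s x hx
    rw [mul_smul]; exact Set.smul_mem_smul_set hx
  have habs : ∀ {A : Set E}, Bornology.IsVonNBounded ℝ A → ∀ W ∈ 𝓝 (0 : E),
      ∃ r : ℝ, 1 ≤ r ∧ A ⊆ r • W := by
    intro A hA W hW
    obtain ⟨r, hr⟩ := ((hA hW).exists_pos)
    refine ⟨max r 1, le_max_right _ _, hr.2 _ ?_⟩
    rw [Real.norm_of_nonneg (by positivity)]; exact le_max_left _ _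
  obtain ⟨c, hc1, hc⟩ := habs (hUb.add hUb) U hU
  have hc0 : 0 < c := by linarith
  have hadd : ∀ {s : ℝ} {x y : E}, x ∈ s • U → y ∈ s • U → x + y ∈ (c * s) • U := by
    rintro s _ _ ⟨x, hx, rfl⟩ ⟨y, hy, rfl⟩
    have := hscale s (hc (Set.add_mem_add hx hy))
    rw [mul_comm]
    simpa [smul_add] using this
  -- With `c / b ≤ 1 / 2`, the factor `1 / b` on the remainder outweighs the loss `c` from one
  -- addition.
  obtain ⟨b, hb⟩ := exists_nat_ge (2 * c)
  have hb1 : (1 : ℝ) ≤ b := by linarith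
  have hbpos : 0 < b := by exact_mod_cast (by linarith : (0 : ℝ) < b)
  -- sums of `n` elements
  have hsum : ∀ (n : ℕ) (s : ℝ) (y : ℕ → E), 0 ≤ s → (∀ k, y k ∈ s • U) →
      ∑ k ∈ Finset.range n, y k ∈ (c ^ n * s) • U := by
    intro n s y hs hy
    induction n with
    | zero => simpa using Set.smul_mem_smul_set (a := s) (mem_of_mem_nhds hU)
    | succ n ih =>
      rw [Finset.sum_range_succ, pow_succ', mul_assoc]
      refine hadd ih (hmono hs ?_ (hy n))
      exact le_mul_of_one_le_left hs (one_le_pow₀ hc1)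
  have key : ∀ (x : ι → E) (F : Finset ι), (∀ G ⊆ F, ∑ i ∈ G, x i ∈ (c ^ b)⁻¹ • U) →
      ∀ a : ι → ℝ, (∀ i, 0 ≤ a i) → (∀ i, a i ≤ 1) → ∑ i ∈ F, a i • x i ∈ (b : ℝ) • U := by
    intro x F hF
    -- an a priori bound
    have hK : ∃ K : ℝ, (b : ℝ) ≤ K ∧ ∀ a : ι → ℝ, (∀ i, 0 ≤ a i) → (∀ i, a i ≤ 1) →
        ∑ i ∈ F, a i • x i ∈ K • U := by
      clear hF
      induction F using Finset.induction_on with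
      | empty =>
        refine ⟨b, le_rfl, fun a _ _ => ?_⟩
        simpa using Set.smul_mem_smul_set (a := (b : ℝ)) (mem_of_mem_nhds hU)
      | insert i F hi ih =>
        obtain ⟨K, hK, hKF⟩ := ih
        obtain ⟨r, hr1, hr⟩ := habs (Bornology.isVonNBounded_singleton (x i)) U hU
        have hxi : x i ∈ r • U := hr rfl
        refine ⟨c * max r K, ?_, fun a ha ha' => ?_⟩
        · exact (hK.trans (le_max_right r K)).trans
            (le_mul_of_one_le_left (by positivity) hc1)
        · rw [Finset.sum_insert hi]
          refine hadd (hmono ?_ ?_ (hscale (a i) hxi))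
            (hmono (by linarith) (le_max_right _ _) (hKF a ha ha'))
          · exact mul_nonneg (ha i) (by linarith)
          · exact (mul_le_of_le_one_left (by linarith) (ha' i)).trans (le_max_left _ _)
    obtain ⟨K, hbK, hK⟩ := hK
    have hstep : ∀ K : ℝ, (b : ℝ) ≤ K → (∀ a : ι → ℝ, (∀ i, 0 ≤ a i) → (∀ i, a i ≤ 1) →
        ∑ i ∈ F, a i • x i ∈ K • U) → ∀ a : ι → ℝ, (∀ i, 0 ≤ a i) → (∀ i, a i ≤ 1) →
        ∑ i ∈ F, a i • x i ∈ (K / 2) • U := by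
      intro K hbK hK a ha ha'
      have hK0 : 0 < K := by linarith
      rw [sum_smul_eq_inv_smul_sum_layers_add b hbpos x a ha ha' F]
      have h1 := hsum b _ (fun k => ∑ i ∈ F with (k : ℝ) + 1 ≤ b * a i, x i) (by positivity)
        (fun k => hF _ (Finset.filter_subset _ _))
      rw [mul_inv_cancel₀ (by positivity)] at h1
      have h2 := hK (fun i => Int.fract (b * a i)) (fun i => Int.fract_nonneg _)
        (fun i => (Int.fract_lt_one _).le)
      have h3 := hadd (hmono (s := (b : ℝ)⁻¹ * 1) (t := (b : ℝ)⁻¹ * K) (by positivity)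
        (by gcongr; linarith) (hscale _ h1)) (hscale (b : ℝ)⁻¹ h2)
      refine hmono (by positivity) ?_ h3
      have hcb : c * (b : ℝ)⁻¹ ≤ 1 / 2 := by
        rw [← div_eq_mul_inv, div_le_iff₀ (by linarith)]; linarith
      nlinarith
    have hall : ∀ n : ℕ, ∀ a : ι → ℝ, (∀ i, 0 ≤ a i) → (∀ i, a i ≤ 1) →
        ∑ i ∈ F, a i • x i ∈ (max (K / 2 ^ n) b) • U := by
      intro n
      induction n with
      | zero => simpa [max_eq_left hbK] using hK
      | succ n ih =>
        rcases le_total (b : ℝ) (K / 2 ^ n) with h | h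
        · rw [max_eq_left h] at ih
          intro a ha ha'
          refine hmono (by linarith) ?_ (hstep _ h ih a ha ha')
          rw [pow_succ, ← div_div]; exact le_max_left _ _
        · rw [max_eq_right h] at ih
          intro a ha ha'
          exact hmono (by positivity) (le_max_right _ _) (ih a ha ha')
    obtain ⟨n, hn⟩ := pow_unbounded_of_one_lt (K / b) (one_lt_two : (1 : ℝ) < 2)
    have := hall n
    rwa [max_eq_right] at this
    rw [div_lt_iff₀ (by linarith)] at hn
    rw [div_le_iff₀ (by positivity)]; linarith
  intro W hW
  obtain ⟨r, hr1, hr⟩ := habs hUb W hW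
  have hbr : (0 : ℝ) < b * r := by positivity
  -- `c ^ b` pays for adding `b` layers, `b` is the bound from `key`, and `r` passes from `U` to
  -- `W`.
  refine ⟨((b * r)⁻¹ * (c ^ b)⁻¹) • U, (set_smul_mem_nhds_zero_iff (by positivity)).2 hU,
    fun x a F ha ha' h => ?_⟩
  have := key (fun i => (b * r : ℝ) • x i) F (fun G hG => by
    rw [← Finset.smul_sum]
    have := hscale (b * r) (h G hG)
    rwa [← mul_assoc, mul_inv_cancel₀ hbr.ne', one_mul] at this) a ha ha'
  have h2 : (b * r : ℝ) • ∑ i ∈ F, a i • x i ∈ (b * r : ℝ) • W := by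
    rw [Finset.smul_sum, mul_smul (b : ℝ) r W]
    refine Set.smul_set_mono hr ?_
    convert this using 2 with i
    rw [smul_comm]
  exact (Set.smul_mem_smul_set_iff₀ hbr.ne' _ _).1 h2

end RealMultipliers

section Multipliers

variable {ι 𝕜 E : Type*} [RCLike 𝕜] [AddCommGroup E] [Module 𝕜 E]

variable (ι 𝕜 E) in
/-- Finite sums `∑ a i • x i` with coefficients in the unit ball of `𝕜` are uniformly small as
soon as all subsums of `∑ x i` are small. -/
def HasBoundedMultipliers [TopologicalSpace E] : Prop :=
  ∀ W ∈ 𝓝 (0 : E), ∃ V ∈ 𝓝 (0 : E), ∀ (x : ι → E) (a : ι → 𝕜) (F : Finset ι),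
    (∀ i, ‖a i‖ ≤ 1) → (∀ G ⊆ F, ∑ i ∈ G, x i ∈ V) → ∑ i ∈ F, a i • x i ∈ W

/-- A scalar splits into the positive and negative parts of its real and imaginary parts, each in
`[0, 1]`. -/
theorem HasUnitIntervalMultipliers.hasBoundedMultipliers [Module ℝ E] [IsScalarTower ℝ 𝕜 E]
    [TopologicalSpace E] [IsTopologicalAddGroup E] [ContinuousSMul 𝕜 E]
    (h : HasUnitIntervalMultipliers ι E) : HasBoundedMultipliers ι 𝕜 E := by
  intro W hW
  obtain ⟨W₁, hW₁, hW₁'⟩ := exists_nhds_zero_half hW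
  have hI : (fun x : E => (RCLike.I : 𝕜) • x) ⁻¹' W₁ ∈ 𝓝 (0 : E) :=
    (continuous_const_smul (RCLike.I : 𝕜)).continuousAt.preimage_mem_nhds (by simpa using hW₁)
  obtain ⟨W₂, hW₂, hW₂'⟩ := exists_nhds_half_neg (inter_mem hW₁ hI)
  obtain ⟨V, hV, hVW⟩ := h W₂ hW₂
  refine ⟨V, hV, fun x a F ha hF => ?_⟩
  have hreal : ∀ r : ι → ℝ, (∀ i, |r i| ≤ 1) → ∑ i ∈ F, r i • x i ∈
      W₁ ∩ (fun x : E => (RCLike.I : 𝕜) • x) ⁻¹' W₁ := by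
    intro r hr
    have h1 := hVW x (fun i => (r i)⁺) F (fun i => posPart_nonneg _)
      (fun i => (sup_le (le_abs_self _) (abs_nonneg _)).trans (hr i)) hF
    have h2 := hVW x (fun i => (r i)⁻) F (fun i => negPart_nonneg _)
      (fun i => (sup_le (neg_le_abs _) (abs_nonneg _)).trans (hr i)) hF
    have h3 := hW₂' _ h1 _ h2
    rw [← Finset.sum_sub_distrib] at h3
    simpa only [← sub_smul, posPart_sub_negPart] using h3
  have h1 := (hreal (fun i => RCLike.re (a i))
    (fun i => (RCLike.abs_re_le_norm _).trans (ha i))).1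
  have h2 := (hreal (fun i => RCLike.im (a i))
    (fun i => (RCLike.abs_im_le_norm _).trans (ha i))).2
  have h3 := hW₁' _ h1 _ h2
  convert h3 using 1
  dsimp only
  rw [Finset.smul_sum, ← Finset.sum_add_distrib]
  refine Finset.sum_congr rfl fun i _ => ?_
  conv_lhs => rw [← RCLike.re_add_im (a i)]
  rw [add_smul, ← algebraMap_smul 𝕜 (RCLike.re (a i)), ← algebraMap_smul 𝕜 (RCLike.im (a i)),
    smul_smul, mul_comm]

theorem continuousSMul_real [Module ℝ E] [IsScalarTower ℝ 𝕜 E] [TopologicalSpace E]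
    [ContinuousSMul 𝕜 E] : ContinuousSMul ℝ E := by
  refine ⟨?_⟩
  have : Continuous fun p : ℝ × E => ((p.1 : 𝕜)) • p.2 :=
    (RCLike.continuous_ofReal.comp continuous_fst).smul continuous_snd
  refine this.congr fun p => ?_
  exact algebraMap_smul 𝕜 p.1 p.2

theorem hasBoundedMultipliers_of_locallyBounded_or_locallyConvex [Module ℝ E]
    [IsScalarTower ℝ 𝕜 E] [TopologicalSpace E] [IsTopologicalAddGroup E] [ContinuousSMul 𝕜 E]
    (hE : IsLocallyBoundedTVS 𝕜 E ∨ LocallyConvexSpace ℝ E) : HasBoundedMultipliers ι 𝕜 E := by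
  have : ContinuousSMul ℝ E := continuousSMul_real (𝕜 := 𝕜)
  refine HasUnitIntervalMultipliers.hasBoundedMultipliers ?_
  rcases hE with ⟨U, hU, hUb⟩ | h
  · refine hasUnitIntervalMultipliers_of_isVonNBounded hU fun W hW => ?_
    refine Absorbs.restrict_scalars (M := ℝ) (N := 𝕜) (hUb hW) ?_
    rw [← tendsto_norm_atTop_iff_cobounded]
    simpa only [norm_smul, norm_one, mul_one] using tendsto_norm_cobounded_atTop (E := ℝ)
  · exact hasUnitIntervalMultipliers_of_locallyConvexSpace

variable [UniformSpace E] [IsUniformAddGroup E]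

theorem HasBoundedMultipliers.exists_finset_forall_sum_mem (hbm : HasBoundedMultipliers ι 𝕜 E)
    {u : ι → E} {R : ι → ℝ} (hR : ∀ n, 0 ≤ R n) (hs : Summable fun n => (R n : 𝕜) • u n)
    {W : Set E} (hW : W ∈ 𝓝 0) :
    ∃ s : Finset ι, ∀ (y : ι → 𝕜) (t : Finset ι), Disjoint t s → (∀ n ∈ t, ‖y n‖ ≤ R n) →
      ∑ n ∈ t, y n • u n ∈ W := by
  classical
  obtain ⟨V, hV, hVW⟩ := hbm W hW
  obtain ⟨s, hs⟩ := hs.vanishing hV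
  refine ⟨s, fun y t hts hy => ?_⟩
  -- Write `y n • u n = (y n / R n) • (R n • u n)`. The default `0` keeps the multipliers bounded at
  -- indices outside `t`, where nothing is known about `y`.
  have := hVW (fun n => (R n : 𝕜) • u n) (fun n => if ‖y n‖ ≤ R n then y n / (R n : 𝕜) else 0) t
    (fun n => by
      split_ifs with h
      · rw [norm_div, RCLike.norm_ofReal, abs_of_nonneg (hR n)]
        exact div_le_one_of_le₀ h (hR n)
      · simp)
    (fun G hG => hs G (hts.mono_left hG))
  convert this using 1
  refine Finset.sum_congr rfl fun n hn => ?_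
  rw [if_pos (hy n hn), smul_smul]
  rcases eq_or_ne (R n) 0 with h0 | h0
  · have : y n = 0 := by simpa [h0] using hy n hn
    simp [this]
  · rw [div_mul_cancel₀ _ (RCLike.ofReal_ne_zero.2 h0)]

theorem HasBoundedMultipliers.summable [CompleteSpace E] (hbm : HasBoundedMultipliers ι 𝕜 E)
    {u : ι → E} {R : ι → ℝ} (hR : ∀ n, 0 ≤ R n) (hs : Summable fun n => (R n : 𝕜) • u n)
    {y : ι → 𝕜} (hy : ∀ᶠ n in cofinite, ‖y n‖ ≤ R n) : Summable fun n => y n • u n := by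
  classical
  rw [summable_iff_vanishing]
  intro W hW
  obtain ⟨s, hs⟩ := hbm.exists_finset_forall_sum_mem hR hs hW
  refine ⟨s ∪ (eventually_cofinite.1 hy).toFinset, fun t ht => ?_⟩
  rw [Finset.disjoint_union_right] at ht
  refine hs y t ht.1 fun n hn => ?_
  by_contra hcon
  exact Finset.disjoint_left.1 ht.2 hn (by simpa using hcon)

/-- Let `R n` count the `k` with `n ∉ s k`. Then `∑ R n • u n` is a sum of layers, the `k`-th being
a subsum of `∑ u n` off `s k`, hence in `V k`; and `V (k + 1) + V (k + 1) ⊆ V k` makes consecutive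
layers add up to something small. -/
theorem Summable.exists_tendsto_atTop_smul [CompleteSpace E] [FirstCountableTopology E]
    {u : ℤ → E} (hu : Summable u) :
    ∃ R : ℤ → ℝ, (∀ n, 0 ≤ R n) ∧ Tendsto R cofinite atTop ∧
      Summable fun n => (R n : 𝕜) • u n := by
  classical
  obtain ⟨V, hV, hVadd⟩ := IsTopologicalAddGroup.exists_antitone_basis_nhds_zero E
  have hV0 : ∀ k, (0 : E) ∈ V k := fun k => mem_of_mem_nhds (hV.mem k)
  choose s₀ hs₀ using fun k => hu.vanishing (hV.mem k)
  -- an increasing exhaustion of `ℤ` off which subsums are small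
  let s : ℕ → Finset ℤ := fun k =>
    (Finset.range (k + 1)).biUnion fun j => s₀ j ∪ Finset.Icc (-(j : ℤ)) j
  have hsmono : Monotone s := fun k l hkl =>
    Finset.biUnion_subset_biUnion_of_subset_left _ (Finset.range_mono (by omega))
  have hs₀s : ∀ k, s₀ k ∪ Finset.Icc (-(k : ℤ)) k ⊆ s k := fun k =>
    Finset.subset_biUnion_of_mem (fun j : ℕ => s₀ j ∪ Finset.Icc (-(j : ℤ)) j)
      (Finset.mem_range.2 (Nat.lt_succ_self k))
  have hs : ∀ k (t : Finset ℤ), Disjoint t (s k) → ∑ n ∈ t, u n ∈ V k := fun k t ht =>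
    hs₀ k t (ht.mono_right (Finset.subset_union_left.trans (hs₀s k)))
  have hex : ∀ n : ℤ, ∃ k, n ∈ s k := fun n =>
    ⟨n.natAbs, hs₀s _ (Finset.mem_union_right _ (Finset.mem_Icc.2 (by omega)))⟩
  let r : ℤ → ℕ := fun n => Nat.find (hex n)
  have hr : ∀ n k, k < r n ↔ n ∉ s k := by
    intro n k
    refine ⟨fun h => Nat.find_min (hex n) h, fun h => ?_⟩
    by_contra hcon
    exact h (hsmono (not_lt.1 hcon) (Nat.find_spec (hex n)))
  refine ⟨fun n => r n, fun n => Nat.cast_nonneg _, ?_, ?_⟩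
  · refine tendsto_natCast_atTop_atTop.comp (tendsto_atTop.2 fun k => ?_)
    rw [eventually_cofinite]
    refine (s k).finite_toSet.subset fun n hn => ?_
    by_contra hcon
    exact hn ((hr n k).2 hcon).le
  · have hlayer : ∀ t : Finset ℤ, ∀ K : ℕ, (∀ n ∈ t, r n ≤ K) →
        ∑ n ∈ t, ((r n : ℝ) : 𝕜) • u n = ∑ k ∈ Finset.range K, ∑ n ∈ t with n ∉ s k, u n := by
      intro t K hK
      simp_rw [Finset.sum_filter]
      rw [Finset.sum_comm]
      refine Finset.sum_congr rfl fun n hn => ?_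
      rw [← Finset.sum_filter, Finset.sum_const]
      have : (Finset.range K).filter (fun k => n ∉ s k) = Finset.range (r n) := by
        ext k
        simp only [Finset.mem_filter, Finset.mem_range, ← hr]
        exact ⟨fun h => h.2, fun h => ⟨h.trans_le (hK n hn), h⟩⟩
      rw [this, Finset.card_range]
      simp [Nat.cast_smul_eq_nsmul]
    -- sums of consecutive layers are small
    have hconsec : ∀ (g : ℕ → E), (∀ k, g k ∈ V k) → ∀ m k : ℕ,
        ∑ j ∈ Finset.range m, g (k + 1 + j) ∈ V k := by
      intro g hg m
      induction m with
      | zero => intro k; simpa using hV0 k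
      | succ m ih =>
        intro k
        rw [Finset.sum_range_succ']
        refine hVadd k (Set.add_mem_add ?_ ?_)
        · convert ih (k + 1) using 3 with j
          omega
        · simpa using hg (k + 1)
    rw [summable_iff_vanishing]
    intro W hW
    obtain ⟨k, -, hk⟩ := hV.toHasBasis.mem_iff.1 hW
    -- For `t` disjoint from `s (k + 1)`, the layers `0, …, k + 1` all equal the full sum over `t`,
    -- which is thus counted `k + 2` times.
    have hmul : (fun x : E => (k + 2) • x) ⁻¹' V (k + 1) ∈ 𝓝 (0 : E) :=
      (continuous_nsmul (k + 2)).continuousAt.preimage_mem_nhds (by simpa using hV.mem (k + 1))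
    obtain ⟨l, hl⟩ := hu.vanishing hmul
    refine ⟨l ∪ s (k + 1), fun t ht => hk ?_⟩
    rw [Finset.disjoint_union_right] at ht
    set K := t.sup r
    rw [hlayer t (k + 2 + K) (fun n hn => (Finset.le_sup hn).trans (by omega)),
      Finset.sum_range_add]
    refine hVadd k (Set.add_mem_add ?_ ?_)
    · have : ∀ j ∈ Finset.range (k + 2), ∑ n ∈ t with n ∉ s j, u n = ∑ n ∈ t, u n := by
        intro j hj
        rw [Finset.filter_true_of_mem]
        intro n hn hns
        refine Finset.disjoint_left.1 ht.2 hn (hsmono ?_ hns)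
        rw [Finset.mem_range] at hj; omega
      rw [Finset.sum_congr rfl this, Finset.sum_const, Finset.card_range]
      exact hl t ht.1
    · have := hconsec (fun j => ∑ n ∈ t with n ∉ s j, u n)
        (fun j => hs j _ (Finset.disjoint_left.2 fun n hn => (Finset.mem_filter.1 hn).2)) K (k + 1)
      exact this

end Multipliers

/-! ### Strong mixing and frequent hypercyclicity -/

section Density

theorem lowerDensity_isBoundedUnder (A : Set ℕ) :
    IsBoundedUnder (· ≤ ·) atTop (fun N : ℕ => ((A ∩ Set.Iic N).ncard : ℝ) / ((N : ℝ) + 1)) := by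
  refine isBoundedUnder_of ⟨1, fun N => ?_⟩
  rw [div_le_one (by positivity)]
  have h := Set.ncard_le_ncard (Set.inter_subset_right (s := A) (t := Set.Iic N))
    (Set.finite_Iic N)
  have h2 : (Set.Iic N).ncard = N + 1 := by
    rw [← Finset.coe_Iic, Set.ncard_coe_finset, Nat.card_Iic]
  rw [h2] at h
  exact_mod_cast h

theorem lowerDensity_isBoundedUnder_ge (A : Set ℕ) :
    IsBoundedUnder (· ≥ ·) atTop (fun N : ℕ => ((A ∩ Set.Iic N).ncard : ℝ) / ((N : ℝ) + 1)) :=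
  isBoundedUnder_of ⟨0, fun N => by positivity⟩

theorem lowerDensity_mono {A B : Set ℕ} (h : A ⊆ B) : lowerDensity A ≤ lowerDensity B := by
  refine liminf_le_liminf (Eventually.of_forall fun N => ?_) (lowerDensity_isBoundedUnder_ge A)
    (lowerDensity_isBoundedUnder B).isCoboundedUnder_ge
  gcongr
  exact (Set.finite_Iic N).inter_of_right B

/-- For visit times, the bounded quantity is a Birkhoff sum of `c - 1_A`, so an upper bound on these
sums is all that is needed from ergodic theory. -/
theorem lowerDensity_pos_of_forall_le {A : Set ℕ} {c M : ℝ} (hc : 0 < c)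
    (h : ∀ N : ℕ, c * (N + 1) - (A ∩ Set.Iic N).ncard ≤ M) : 0 < lowerDensity A := by
  have hlim : Tendsto (fun N : ℕ => c - M / ((N : ℝ) + 1)) atTop (𝓝 (c - 0)) :=
    tendsto_const_nhds.sub (tendsto_const_nhds.div_atTop
      (tendsto_atTop_add_const_right _ _ tendsto_natCast_atTop_atTop))
  rw [sub_zero] at hlim
  refine (half_pos hc).trans_le (le_liminf_of_le
    (lowerDensity_isBoundedUnder A).isCoboundedUnder_ge ?_)
  filter_upwards [hlim.eventually (lt_mem_nhds (half_lt_self hc))] with N hN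
  refine hN.le.trans ?_
  have hpos : (0 : ℝ) < N + 1 := by positivity
  rw [le_div_iff₀ hpos, sub_mul, div_mul_cancel₀ _ hpos.ne']
  linarith [h N]

end Density

/-! ### Maximal ergodic inequality and criteria for strong mixing -/

section Ergodic

variable {α : Type*} {T : α → α}

/-- The maximum of `0` and the Birkhoff sums of lengths `1, …, n`. -/
def birkhoffMax (T : α → α) (f : α → ℝ) : ℕ → α → ℝ
  | 0 => 0
  | n + 1 => fun x => max 0 (f x + birkhoffMax T f n (T x))

theorem birkhoffMax_nonneg (f : α → ℝ) (n : ℕ) (x : α) : 0 ≤ birkhoffMax T f n x := by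
  cases n with
  | zero => exact le_rfl
  | succ n => exact le_max_left _ _

theorem birkhoffMax_le_succ (f : α → ℝ) (n : ℕ) (x : α) :
    birkhoffMax T f n x ≤ birkhoffMax T f (n + 1) x := by
  induction n generalizing x with
  | zero => exact birkhoffMax_nonneg f 1 x
  | succ n ih => exact max_le_max le_rfl (by gcongr; exact ih (T x))

theorem birkhoffSum_le_birkhoffMax (f : α → ℝ) (n : ℕ) (x : α) :
    birkhoffSum T f n x ≤ birkhoffMax T f n x := by
  induction n generalizing x with
  | zero => exact le_rfl
  | succ n ih =>
    rw [birkhoffSum_succ']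
    exact (by gcongr; exact ih (T x) : _ ≤ f x + birkhoffMax T f n (T x)).trans (le_max_right _ _)

theorem birkhoffSum_const_sub_indicator (A : Set α) (c : ℝ) (N : ℕ) (x : α) :
    birkhoffSum T (fun y => c - A.indicator 1 y) (N + 1) x =
      c * (N + 1) - (({n : ℕ | T^[n] x ∈ A} ∩ Set.Iic N).ncard : ℝ) := by
  classical
  have h : {n : ℕ | T^[n] x ∈ A} ∩ Set.Iic N
      = ↑((Finset.range (N + 1)).filter fun n => T^[n] x ∈ A) := by
    ext n; simp [and_comm]
  rw [h, Set.ncard_coe_finset, birkhoffSum, Finset.sum_sub_distrib, Finset.sum_const,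
    Finset.card_range, ← Finset.sum_boole]
  simp only [Set.indicator_apply, Pi.one_apply]
  rw [nsmul_eq_mul, mul_comm]
  push_cast; rfl

variable [MeasurableSpace α] {μ : Measure α}

theorem MeasureTheory.MeasurePreserving.integrable_birkhoffMax (hT : MeasurePreserving T μ μ)
    {f : α → ℝ} (hf : Integrable f μ) (n : ℕ) : Integrable (birkhoffMax T f n) μ := by
  induction n with
  | zero => exact integrable_zero _ _ _
  | succ n ih => exact (integrable_zero _ _ _).sup (hf.add (hT.integrable_comp_of_integrable ih))

theorem measurable_birkhoffMax (hT : Measurable T) {f : α → ℝ} (hf : Measurable f) (n : ℕ) :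
    Measurable (birkhoffMax T f n) := by
  induction n with
  | zero => exact measurable_const
  | succ n ih => exact measurable_const.max (hf.add (ih.comp hT))

/-- The maximal ergodic inequality. -/
theorem MeasureTheory.MeasurePreserving.setIntegral_birkhoffMax_pos_nonneg
    (hT : MeasurePreserving T μ μ) {f : α → ℝ} (hfm : Measurable f) (hf : Integrable f μ) (n : ℕ) :
    0 ≤ ∫ x in {x | 0 < birkhoffMax T f n x}, f x ∂μ := by
  cases n with
  | zero => simp [birkhoffMax]
  | succ n =>
    set F := birkhoffMax T f (n + 1) with hF
    have hFi : Integrable F μ := hT.integrable_birkhoffMax hf _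
    have hFTi : Integrable (fun x => F (T x)) μ := hT.integrable_comp_of_integrable hFi
    have hms : MeasurableSet {x | 0 < F x} :=
      measurableSet_lt measurable_const (measurable_birkhoffMax hT.measurable hfm _)
    have h0 : ∫ x, F (T x) ∂μ = ∫ x, F x ∂μ := by
      rw [← integral_map hT.measurable.aemeasurable (by rw [hT.map_eq]; exact hFi.1), hT.map_eq]
    -- Garsia's argument: `F ≤ f + F ∘ T` where `F > 0`, while elsewhere `F = 0 ≤ F ∘ T`.
    calc (0 : ℝ) = ∫ x, F x ∂μ - ∫ x, F (T x) ∂μ := by rw [h0, sub_self]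
      _ ≤ ∫ x in {x | 0 < F x}, F x ∂μ - ∫ x in {x | 0 < F x}, F (T x) ∂μ := by
        refine sub_le_sub (le_of_eq ?_) (setIntegral_le_integral hFTi
          (Eventually.of_forall fun x => birkhoffMax_nonneg f _ _))
        refine (setIntegral_eq_integral_of_forall_compl_eq_zero fun x hx => ?_).symm
        exact le_antisymm (not_lt.1 hx) (birkhoffMax_nonneg f _ _)
      _ = ∫ x in {x | 0 < F x}, (F x - F (T x)) ∂μ :=
        (integral_sub hFi.integrableOn hFTi.integrableOn).symm
      _ ≤ ∫ x in {x | 0 < F x}, f x ∂μ := by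
        refine setIntegral_mono_on (hFi.sub hFTi).integrableOn hf.integrableOn hms fun x hx => ?_
        have h1 : F x = f x + birkhoffMax T f n (T x) := by
          have hx' : 0 < max 0 (f x + birkhoffMax T f n (T x)) := hx
          have : 0 < f x + birkhoffMax T f n (T x) := by
            simpa using hx'
          exact max_eq_right this.le
        have h2 := birkhoffMax_le_succ (T := T) f n (T x)
        rw [h1]; linarith

theorem MeasureTheory.MeasurePreserving.integral_nonneg_of_ae_exists_birkhoffSum_pos
    (hT : MeasurePreserving T μ μ) {f : α → ℝ} (hfm : Measurable f) (hf : Integrable f μ)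
    (h : ∀ᵐ x ∂μ, ∃ n, 0 < birkhoffSum T f n x) : 0 ≤ ∫ x, f x ∂μ := by
  have hmono : Monotone fun n => {x | 0 < birkhoffMax T f n x} :=
    monotone_nat_of_le_succ fun n x hx => lt_of_lt_of_le hx (birkhoffMax_le_succ f n x)
  have hlim := tendsto_setIntegral_of_monotone (μ := μ) (f := f)
    (s := fun n => {x | 0 < birkhoffMax T f n x})
    (fun n => measurableSet_lt measurable_const (measurable_birkhoffMax hT.measurable hfm _))
    hmono hf.integrableOn
  have huniv : (⋃ n, {x | 0 < birkhoffMax T f n x}) =ᵐ[μ] Set.univ := by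
    rw [eventuallyEq_univ]
    filter_upwards [h] with x ⟨n, hn⟩
    exact Set.mem_iUnion.2 ⟨n, hn.trans_le (birkhoffSum_le_birkhoffMax f n x)⟩
  rw [setIntegral_congr_set huniv, setIntegral_univ] at hlim
  exact ge_of_tendsto' hlim fun n => hT.setIntegral_birkhoffMax_pos_nonneg hfm hf n

theorem IsStronglyMixing.measure_eq_zero_or_one [IsProbabilityMeasure μ]
    (h : IsStronglyMixing T μ) {B : Set α} (hB : MeasurableSet B) (hTB : T ⁻¹' B = B) :
    μ B = 0 ∨ μ B = 1 := by
  have hn : ∀ n : ℕ, T^[n] ⁻¹' B = B := fun n => by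
    rw [Set.preimage_iterate_eq]
    exact Function.iterate_fixed hTB n
  have h1 := h.2 B B hB hB
  simp_rw [hn, Set.inter_self] at h1
  have h2 : μ B = μ B * μ B := tendsto_nhds_unique tendsto_const_nhds h1
  rcases eq_or_ne (μ B) 0 with h0 | h0
  · exact Or.inl h0
  · right
    have h3 : μ B * 1 = μ B * μ B := by rw [mul_one]; exact h2
    exact ((ENNReal.mul_right_inj h0 (measure_ne_top _ _)).1 h3).symm

/-- The function `g = c - 1_A` with `c = μ A / 2` has negative integral. The set where its Birkhoff
sums are unbounded above is invariant, so null or of full measure; the latter would force `∫ g ≥ 0`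
by the maximal inequality. The sums are thus almost surely bounded above, and the pointwise ergodic
theorem is not needed. -/
theorem IsStronglyMixing.ae_lowerDensity_pos [IsProbabilityMeasure μ]
    (h : IsStronglyMixing T μ) {A : Set α} (hA : MeasurableSet A) (hpos : μ A ≠ 0) :
    ∀ᵐ x ∂μ, 0 < lowerDensity {n : ℕ | T^[n] x ∈ A} := by
  have hApos : 0 < μ.real A := ENNReal.toReal_pos hpos (measure_ne_top _ _)
  set c := μ.real A / 2 with hc
  set g : α → ℝ := fun y => c - A.indicator 1 y with hg
  have hgm : Measurable g := measurable_const.sub (measurable_one.indicator hA)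
  have hgi : Integrable g μ :=
    (integrable_const c).sub ((integrable_const (1 : ℝ)).indicator hA)
  have hT := h.1
  have hSm : ∀ n, Measurable (birkhoffSum T g n) := fun n =>
    Finset.measurable_sum _ fun k _ => hgm.comp (hT.measurable.iterate k)
  set B : Set α := {x | ∀ M : ℕ, ∃ n, (M : ℝ) < birkhoffSum T g n x} with hB
  have hBm : MeasurableSet B := by
    have : B = ⋂ M : ℕ, ⋃ n, {x | (M : ℝ) < birkhoffSum T g n x} := by ext x; simp [hB]
    rw [this]
    exact MeasurableSet.iInter fun M => MeasurableSet.iUnion fun n =>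
      measurableSet_lt measurable_const (hSm n)
  have hgle : ∀ x, |g x| ≤ c + 1 := by
    intro x
    rw [abs_le]
    have h0 : (0 : ℝ) ≤ A.indicator 1 x := Set.indicator_nonneg (fun _ _ => zero_le_one) x
    have h1 : A.indicator (1 : α → ℝ) x ≤ 1 := Set.indicator_le_self' (fun _ _ => zero_le_one) x
    constructor <;> simp only [hg] <;> linarith
  have hTB : T ⁻¹' B = B := by
    -- Passing from `x` to `T x` drops one term of size at most `K`, which does not affect
    -- unboundedness.
    obtain ⟨K, hK⟩ := exists_nat_ge (c + 1)
    ext x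
    constructor
    · intro hx M
      obtain ⟨n, hn⟩ := hx (M + K)
      refine ⟨n + 1, ?_⟩
      rw [birkhoffSum_succ']
      push_cast at hn
      linarith [(abs_le.1 (hgle x)).1]
    · intro hx M
      obtain ⟨n, hn⟩ := hx (M + K)
      push_cast at hn
      cases n with
      | zero =>
        rw [birkhoffSum_zero] at hn
        have : (0 : ℝ) ≤ M := Nat.cast_nonneg _
        have : (0 : ℝ) ≤ K := Nat.cast_nonneg _
        linarith
      | succ n =>
        rw [birkhoffSum_succ'] at hn
        exact ⟨n, by linarith [(abs_le.1 (hgle x)).2]⟩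
  have hB0 : μ B = 0 := by
    rcases h.measure_eq_zero_or_one hBm hTB with h0 | h1
    · exact h0
    · exfalso
      have hae : ∀ᵐ x ∂μ, x ∈ B := (prob_compl_eq_zero_iff hBm).2 h1
      have h2 := hT.integral_nonneg_of_ae_exists_birkhoffSum_pos hgm hgi
        (hae.mono fun x hx => by simpa using hx 0)
      have h3 : ∫ x, g x ∂μ = c - μ.real A := by
        rw [← integral_indicator_one hA]
        change ∫ x, (c - A.indicator (fun _ => (1 : ℝ)) x) ∂μ = c - ∫ x, A.indicator 1 x ∂μ
        rw [integral_sub (integrable_const c) ((integrable_const (1 : ℝ)).indicator hA)]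
        simp [Pi.one_def]
      linarith
  filter_upwards [measure_eq_zero_iff_ae_notMem.1 hB0] with x hx
  simp only [hB, Set.mem_ofPred_eq, not_forall, not_exists, not_lt] at hx
  obtain ⟨M, hM⟩ := hx
  refine lowerDensity_pos_of_forall_le (c := c) (M := M) (by linarith) fun N => ?_
  rw [← birkhoffSum_const_sub_indicator]
  exact hM (N + 1)

theorem IsStronglyMixing.ae_isFrequentlyHypercyclic [TopologicalSpace α] [BorelSpace α]
    [SecondCountableTopology α] [IsProbabilityMeasure μ] [μ.IsOpenPosMeasure]
    (h : IsStronglyMixing T μ) : ∀ᵐ x ∂μ, IsFrequentlyHypercyclic T x := by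
  have hb := TopologicalSpace.isBasis_countableBasis α
  have : ∀ᵐ x ∂μ, ∀ V ∈ TopologicalSpace.countableBasis α,
      0 < lowerDensity {n : ℕ | T^[n] x ∈ V} := by
    rw [ae_ball_iff (TopologicalSpace.countable_countableBasis α)]
    intro V hV
    have hVo := TopologicalSpace.isOpen_of_mem_countableBasis hV
    exact h.ae_lowerDensity_pos hVo.measurableSet
      (hVo.measure_ne_zero μ (TopologicalSpace.nonempty_of_mem_countableBasis hV))
  filter_upwards [this] with x hx U hU hUne
  obtain ⟨y, hy⟩ := hUne
  obtain ⟨V, hV, -, hVU⟩ := hb.exists_subset_of_mem_open hy hU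
  exact (hx V hV).trans_le (lowerDensity_mono fun n hn => hVU hn)

/-- The common majorant `κ` permits dominated convergence for series, which carries the limit
through countable disjoint unions. -/
theorem tendsto_measureReal_of_isPiSystem {ρ : ℕ → Measure α} {ρ' κ : Measure α}
    [∀ n, IsFiniteMeasure (ρ n)] [IsFiniteMeasure ρ'] [IsFiniteMeasure κ] (hle : ∀ n, ρ n ≤ κ)
    (huniv : Tendsto (fun n => (ρ n).real Set.univ) atTop (𝓝 (ρ'.real Set.univ)))
    {C : Set (Set α)} (hgen : ‹MeasurableSpace α› = MeasurableSpace.generateFrom C)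
    (hC : IsPiSystem C)
    (h : ∀ s ∈ C, Tendsto (fun n => (ρ n).real s) atTop (𝓝 (ρ'.real s)))
    {s : Set α} (hs : MeasurableSet s) :
    Tendsto (fun n => (ρ n).real s) atTop (𝓝 (ρ'.real s)) := by
  induction s, hs using MeasurableSpace.induction_on_inter hgen hC with
  | empty => simp
  | basic t ht => exact h t ht
  | compl t htm ih =>
    simp_rw [measureReal_compl htm]
    exact huniv.sub ih
  | iUnion f hf hfm ih =>
    have hU : ∀ ρ : Measure α, IsFiniteMeasure ρ →
        HasSum (fun i => ρ.real (f i)) (ρ.real (⋃ i, f i)) := by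
      intro ρ _
      have hne : ∑' i, ρ (f i) ≠ ⊤ := by
        rw [← measure_iUnion hf hfm]; exact measure_ne_top _ _
      have := (ENNReal.summable_toReal hne).hasSum
      rwa [← ENNReal.tsum_toReal_eq (fun i => measure_ne_top _ _), ← measure_iUnion hf hfm] at this
    simp_rw [← fun n => (hU (ρ n) inferInstance).tsum_eq, ← (hU ρ' inferInstance).tsum_eq]
    refine tendsto_tsum_of_dominated_convergence (hU κ inferInstance).summable ih
      (Eventually.of_forall fun n i => ?_)
    rw [Real.norm_of_nonneg measureReal_nonneg]
    exact ENNReal.toReal_mono (measure_ne_top _ _) (hle n _)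

theorem isStronglyMixing_iff_real [IsProbabilityMeasure μ] :
    IsStronglyMixing T μ ↔ MeasurePreserving T μ μ ∧
      ∀ A B : Set α, MeasurableSet A → MeasurableSet B →
        Tendsto (fun n : ℕ => μ.real (A ∩ T^[n] ⁻¹' B)) atTop (𝓝 (μ.real A * μ.real B)) := by
  unfold IsStronglyMixing
  refine and_congr_right fun _ => forall₄_congr fun A B _ _ => ?_
  rw [← ENNReal.tendsto_toReal_iff (fun n => measure_ne_top _ _)
    (ENNReal.mul_ne_top (measure_ne_top _ _) (measure_ne_top _ _)), ENNReal.toReal_mul]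
  rfl

/-- The sets are freed one at a time; with the other set fixed, the measures are dominated by `μ`,
by invariance in the case of `B`. -/
theorem isStronglyMixing_of_isPiSystem [IsProbabilityMeasure μ] (hT : MeasurePreserving T μ μ)
    {C : Set (Set α)} (hgen : ‹MeasurableSpace α› = MeasurableSpace.generateFrom C)
    (hC : IsPiSystem C) (h : ∀ A ∈ C, ∀ B ∈ C,
      Tendsto (fun n : ℕ => μ.real (A ∩ T^[n] ⁻¹' B)) atTop (𝓝 (μ.real A * μ.real B))) :
    IsStronglyMixing T μ := by
  have hCm : ∀ A ∈ C, MeasurableSet A := fun A hA => by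
    rw [hgen]; exact MeasurableSpace.measurableSet_generateFrom hA
  have hTn : ∀ n : ℕ, MeasurePreserving T^[n] μ μ := fun n => hT.iterate n
  rw [isStronglyMixing_iff_real]
  refine ⟨hT, ?_⟩
  -- arbitrary second set
  have h1 : ∀ A ∈ C, ∀ B, MeasurableSet B →
      Tendsto (fun n : ℕ => μ.real (A ∩ T^[n] ⁻¹' B)) atTop (𝓝 (μ.real A * μ.real B)) := by
    intro A hA B hB
    have hρ : ∀ n, ∀ S, MeasurableSet S →
        ((μ.restrict A).map T^[n]) S = μ (A ∩ T^[n] ⁻¹' S) := fun n S hS => by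
      rw [Measure.map_apply (hTn n).measurable hS, Measure.restrict_apply
        ((hTn n).measurable hS), Set.inter_comm]
    have hρr : ∀ n, ∀ S, MeasurableSet S →
        ((μ.restrict A).map T^[n]).real S = μ.real (A ∩ T^[n] ⁻¹' S) := fun n S hS => by
      rw [measureReal_def, hρ n S hS]; rfl
    have hρ' : ∀ S, (μ A • μ).real S = μ.real A * μ.real S := fun S => by
      simp [measureReal_def]
    have : IsFiniteMeasure (μ A • μ) := Measure.smul_finite _ (measure_ne_top _ _)
    have := tendsto_measureReal_of_isPiSystem (ρ := fun n => (μ.restrict A).map T^[n])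
      (ρ' := μ A • μ) (κ := μ)
      (fun n => by
        conv_rhs => rw [← (hTn n).map_eq]
        exact Measure.map_mono Measure.restrict_le_self (hTn n).measurable)
      (by
        simp_rw [fun n => hρr n _ MeasurableSet.univ, hρ']
        simp)
      hgen hC
      (fun S hS => by
        simp_rw [fun n => hρr n _ (hCm S hS), hρ']
        exact h A hA S hS) hB
    simp_rw [fun n => hρr n _ hB, hρ'] at this
    exact this
  intro A B hA hB
  have hρr : ∀ n, ∀ S, (μ.restrict (T^[n] ⁻¹' B)).real S = μ.real (S ∩ T^[n] ⁻¹' B) :=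
    fun n S => by
      rw [measureReal_def, Measure.restrict_apply' ((hTn n).measurable hB)]; rfl
  have hρ' : ∀ S, (μ B • μ).real S = μ.real S * μ.real B := fun S => by
    simp [measureReal_def, mul_comm]
  have : IsFiniteMeasure (μ B • μ) := Measure.smul_finite _ (measure_ne_top _ _)
  have := tendsto_measureReal_of_isPiSystem (ρ := fun n => μ.restrict (T^[n] ⁻¹' B))
    (ρ' := μ B • μ) (κ := μ) (fun n => Measure.restrict_le_self)
    (by
      simp_rw [hρr, hρ', Set.univ_inter, fun n => (hTn n).measureReal_preimage hB.nullMeasurableSet]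
      simp)
    hgen hC
    (fun S hS => by
      simp_rw [hρr, hρ']
      exact h1 S hS B hB) hA
  simp_rw [hρr, hρ'] at this
  exact this

/-- Strong mixing passes to factors. -/
theorem IsStronglyMixing.of_semiconj {β : Type*} [MeasurableSpace β] {σ : β → β} {ν : Measure β}
    (h : IsStronglyMixing σ ν) {Φ : β → α} (hΦ : AEMeasurable Φ ν) (hT : Measurable T)
    (hconj : ∀ᵐ y ∂ν, Φ (σ y) = T (Φ y)) : IsStronglyMixing T (ν.map Φ) := by
  have hn : ∀ n : ℕ, ∀ᵐ y ∂ν, Φ (σ^[n] y) = T^[n] (Φ y) := by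
    intro n
    induction n with
    | zero => exact Eventually.of_forall fun _ => rfl
    | succ n ih =>
      have h1 : ∀ᵐ y ∂ν, Φ (σ (σ^[n] y)) = T (Φ (σ^[n] y)) :=
        (h.1.iterate n).quasiMeasurePreserving.ae hconj
      filter_upwards [ih, h1] with y hy hy1
      rw [Function.iterate_succ_apply', Function.iterate_succ_apply', hy1, hy]
  have hmp : (ν.map Φ).map T = ν.map Φ := by
    rw [AEMeasurable.map_map_of_aemeasurable hT.aemeasurable hΦ]
    have : (T ∘ Φ) =ᵐ[ν] Φ ∘ σ := hconj.mono fun y hy => hy.symm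
    rw [Measure.map_congr this, ← AEMeasurable.map_map_of_aemeasurable (by rwa [h.1.map_eq])
      h.1.measurable.aemeasurable, h.1.map_eq]
  refine ⟨⟨hT, hmp⟩, fun A B hA hB => ?_⟩
  -- `Φ` is only almost everywhere measurable; invariance transports `Φ = Ψ` along the iterates of
  -- `σ`.
  set Ψ := hΦ.mk Φ
  have hΨ : Measurable Ψ := hΦ.measurable_mk
  have hΦΨ : Φ =ᵐ[ν] Ψ := hΦ.ae_eq_mk
  have key := h.2 (Ψ ⁻¹' A) (Ψ ⁻¹' B) (hΨ hA) (hΨ hB)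
  rw [Measure.map_congr hΦΨ, Measure.map_apply hΨ hA, Measure.map_apply hΨ hB]
  refine key.congr fun n => ?_
  rw [Measure.map_apply hΨ (hA.inter ((hT.iterate n) hB))]
  refine measure_congr ?_
  filter_upwards [hn n, hΦΨ, (h.1.iterate n).quasiMeasurePreserving.ae hΦΨ] with y h1 h2 h3
  have : Ψ (σ^[n] y) = T^[n] (Ψ y) := by rw [← h3, h1, h2]
  refine propext ?_
  change (Ψ y ∈ A ∧ Ψ (σ^[n] y) ∈ B) ↔ (Ψ y ∈ A ∧ T^[n] (Ψ y) ∈ B)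
  rw [this]

end Ergodic

/-! ### Bernoulli shifts -/

section Bernoulli

variable {F : Type*}

/-- The left shift on two-sided sequences. -/
def leftShift (y : ℤ → F) : ℤ → F := fun n => y (n + 1)

theorem leftShift_iterate (n : ℕ) (y : ℤ → F) : leftShift^[n] y = fun k => y (k + n) := by
  induction n with
  | zero => simp
  | succ n ih =>
    rw [Function.iterate_succ_apply', ih]
    funext k
    simp [leftShift, add_assoc, add_comm (1 : ℤ)]

variable [MeasurableSpace F] (m : Measure F) [IsProbabilityMeasure m]

theorem measurePreserving_leftShift :
    MeasurePreserving leftShift (Measure.infinitePi fun _ : ℤ => m)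
      (Measure.infinitePi fun _ : ℤ => m) := by
  have hm : Measurable (leftShift (F := F)) :=
    measurable_pi_iff.2 fun n => measurable_pi_apply (n + 1)
  refine ⟨hm, Measure.eq_infinitePi _ fun s t ht => ?_⟩
  rw [Measure.map_apply hm (MeasurableSet.pi s.countable_toSet fun i _ => ht i)]
  have : leftShift ⁻¹' ((s : Set ℤ).pi t)
      = ((s.map (addRightEmbedding 1) : Finset ℤ) : Set ℤ).pi fun i => t (i - 1) := by
    ext y
    simp only [Set.mem_preimage, Set.mem_pi, Finset.mem_coe, Finset.forall_mem_map, leftShift,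
      addRightEmbedding_apply, add_sub_cancel_right]
  rw [this, Measure.infinitePi_pi _ (fun i _ => ht _), Finset.prod_map]
  simp

/-- The Bernoulli shift is strongly mixing. -/
theorem isStronglyMixing_leftShift :
    IsStronglyMixing leftShift (Measure.infinitePi fun _ : ℤ => m) := by
  classical
  refine isStronglyMixing_of_isPiSystem (measurePreserving_leftShift m)
    (generateFrom_squareCylinders (α := fun _ : ℤ => F)).symm
    (isPiSystem_squareCylinders (fun _ => MeasurableSpace.isPiSystem_measurableSet)
      (fun _ => MeasurableSet.univ)) ?_
  rintro _ ⟨s, t, ht, rfl⟩ _ ⟨s', t', ht', rfl⟩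
  change ℤ → Set F at t t'
  replace ht : ∀ i, MeasurableSet (t i) := fun i => ht i (Set.mem_univ i)
  replace ht' : ∀ i, MeasurableSet (t' i) := fun i => ht' i (Set.mem_univ i)
  -- For large `n` the two cylinders constrain disjoint sets of coordinates, so the mixing limit is
  -- attained exactly.
  have hlarge : ∀ᶠ n : ℕ in atTop, ∀ i ∈ s, ∀ j ∈ s', i < j + n := by
    simp_rw [eventually_all_finset]
    intro i _ j _
    filter_upwards [eventually_gt_atTop (i - j).toNat] with n hn
    omega
  refine tendsto_const_nhds.congr' ?_
  filter_upwards [hlarge] with n hn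
  have hdisj : Disjoint s (s'.map (addRightEmbedding (n : ℤ))) := by
    rw [Finset.disjoint_left]
    intro i hi hi'
    obtain ⟨j, hj, rfl⟩ := Finset.mem_map.1 hi'
    exact lt_irrefl _ (hn _ hi j hj)
  have hset : (s : Set ℤ).pi t ∩ leftShift^[n] ⁻¹' ((s' : Set ℤ).pi t')
      = ((s ∪ s'.map (addRightEmbedding (n : ℤ)) : Finset ℤ) : Set ℤ).pi
        fun i => if i ∈ s then t i else t' (i - n) := by
    ext y
    simp only [Set.mem_inter_iff, Set.mem_preimage, leftShift_iterate, Set.mem_pi,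
      Finset.mem_coe, Finset.mem_union]
    constructor
    · rintro ⟨h1, h2⟩ i hi
      split_ifs with his
      · exact h1 i his
      · obtain ⟨j, hj, rfl⟩ := Finset.mem_map.1 (hi.resolve_left his)
        simpa only [addRightEmbedding_apply, add_sub_cancel_right] using h2 j hj
    · intro h
      refine ⟨fun i hi => by simpa [hi] using h i (Or.inl hi), fun j hj => ?_⟩
      have hj' : j + (n : ℤ) ∉ s := fun hcon => lt_irrefl _ (hn _ hcon j hj)
      have := h (j + n) (Or.inr (Finset.mem_map.2 ⟨j, hj, rfl⟩))
      simpa only [if_neg hj', add_sub_cancel_right] using this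
  rw [hset, measureReal_def, measureReal_def, measureReal_def, Measure.infinitePi_pi _ (fun i _ => ht i),
    Measure.infinitePi_pi _ (fun i _ => ht' i), Measure.infinitePi_pi, ← ENNReal.toReal_mul,
    Finset.prod_union hdisj, Finset.prod_map]
  · congr 2
    · exact Finset.prod_congr rfl fun i hi => by rw [if_pos hi]
    · refine Finset.prod_congr rfl fun j hj => ?_
      have hj' : j + (n : ℤ) ∉ s := fun hcon => lt_irrefl _ (hn _ hcon j hj)
      rw [addRightEmbedding_apply, if_neg hj', add_sub_cancel_right]
  · intro i _
    split_ifs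
    exacts [ht i, ht' _]

end Bernoulli

/-! ### Random series `∑ Y n • u n` -/

theorem secondCountableTopology_of_dense_span {ι 𝕜 E : Type*} [Countable ι] [RCLike 𝕜]
    [AddCommGroup E] [Module 𝕜 E] [UniformSpace E] [IsUniformAddGroup E] [ContinuousSMul 𝕜 E]
    [FirstCountableTopology E] {e : ι → E}
    (h : Dense (Submodule.span 𝕜 (Set.range e) : Set E)) : SecondCountableTopology E := by
  have h1 : TopologicalSpace.IsSeparable (Submodule.span 𝕜 (Set.range e) : Set E) :=
    (Set.countable_range e).isSeparable.span
  have h2 : TopologicalSpace.SeparableSpace E := by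
    rw [← TopologicalSpace.isSeparable_univ_iff, ← h.closure_eq]
    exact h1.closure
  have h3 : (uniformity E).IsCountablyGenerated := IsUniformAddGroup.uniformity_countably_generated
  exact UniformSpace.secondCountable_of_separable E

section Series

variable {𝕜 E : Type*} [RCLike 𝕜] [AddCommGroup E] [Module 𝕜 E]
  [UniformSpace E] [IsUniformAddGroup E] {u : ℤ → E} {R : ℤ → ℝ} {m : Measure 𝕜} [IsProbabilityMeasure m]

/-- Borel–Cantelli. -/
theorem ae_eventually_norm_le_infinitePi (hm : ∑' n, m {z | R n < ‖z‖} ≠ ⊤) :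
    ∀ᵐ y ∂(Measure.infinitePi fun _ : ℤ => m), ∀ᶠ n in cofinite, ‖y n‖ ≤ R n := by
  have h : ∀ n, (Measure.infinitePi fun _ : ℤ => m) {y | R n < ‖y n‖} = m {z | R n < ‖z‖} :=
    fun n => (measurePreserving_eval_infinitePi (fun _ : ℤ => m) n).measure_preimage
      (measurableSet_lt measurable_const measurable_norm).nullMeasurableSet
  have h2 := ae_finite_setOfPred_mem (μ := Measure.infinitePi fun _ : ℤ => m)
    (s := fun n : ℤ => {y : ℤ → 𝕜 | R n < ‖y n‖}) (by simpa only [h] using hm)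
  filter_upwards [h2] with y hy
  rw [eventually_cofinite]
  simpa using hy

theorem HasBoundedMultipliers.ae_summable [CompleteSpace E] (hbm : HasBoundedMultipliers ℤ 𝕜 E) (hR : ∀ n, 0 ≤ R n)
    (hs : Summable fun n => (R n : 𝕜) • u n) (hm : ∑' n, m {z | R n < ‖z‖} ≠ ⊤) :
    ∀ᵐ y ∂(Measure.infinitePi fun _ : ℤ => m), Summable fun n => y n • u n :=
  (ae_eventually_norm_le_infinitePi hm).mono fun _ hy => hbm.summable hR hs hy

theorem tsum_leftShift_smul {E : Type*} [AddCommGroup E] [Module 𝕜 E] [TopologicalSpace E]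
    [T2Space E] {u : ℤ → E} {T : E →L[𝕜] E} (hT : ∀ n, T (u n) = u (n - 1)) {y : ℤ → 𝕜}
    (hy : Summable fun n => y n • u n) :
    ∑' n, leftShift y n • u n = T (∑' n, y n • u n) := by
  rw [T.map_tsum hy, ← (Equiv.addRight (1 : ℤ)).tsum_eq fun n => T (y n • u n)]
  simp [leftShift, hT]

theorem aemeasurable_tsum_smul [ContinuousSMul 𝕜 E] [MeasurableSpace E] [BorelSpace E] [SecondCountableTopology E]
    [TopologicalSpace.PseudoMetrizableSpace E]
    {ν : Measure (ℤ → 𝕜)} (h : ∀ᵐ y ∂ν, Summable fun n => y n • u n) :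
    AEMeasurable (fun y : ℤ → 𝕜 => ∑' n, y n • u n) ν := by
  let s : ℕ → Finset ℤ := fun N => Finset.Icc (-(N : ℤ)) N
  have hs : Tendsto s atTop atTop := by
    refine tendsto_atTop_finset_of_monotone (fun a b hab => Finset.Icc_subset_Icc (by omega)
      (by omega)) fun n => ⟨n.natAbs, Finset.mem_Icc.2 (by omega)⟩
  refine aemeasurable_of_tendsto_metrizable_ae atTop
    (f := fun N (y : ℤ → 𝕜) => ∑ n ∈ s N, y n • u n) (fun N => ?_) ?_
  · have : Continuous fun y : ℤ → 𝕜 => ∑ n ∈ s N, y n • u n := by fun_prop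
    exact this.measurable.aemeasurable
  · filter_upwards [h] with y hy
    exact hy.hasSum.comp hs

/-- The tail event involves infinitely many coordinates, so independence is taken between the
σ-algebras generated by `s` and by its complement. -/
theorem indep_box_tail {s : Finset ℤ} {t t' : ℤ → Set 𝕜} (ht : ∀ n, MeasurableSet (t n))
    (ht' : ∀ n, MeasurableSet (t' n)) :
    (Measure.infinitePi fun _ : ℤ => m) ({y | ∀ n ∈ s, y n ∈ t n} ∩ {y | ∀ n ∉ s, y n ∈ t' n}) =
      (Measure.infinitePi fun _ : ℤ => m) {y | ∀ n ∈ s, y n ∈ t n} *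
        (Measure.infinitePi fun _ : ℤ => m) {y | ∀ n ∉ s, y n ∈ t' n} := by
  have hind : iIndepFun (fun (n : ℤ) (y : ℤ → 𝕜) => y n) (Measure.infinitePi fun _ : ℤ => m) :=
    iIndepFun_infinitePi (P := fun _ : ℤ => m) (X := fun _ => id) fun _ => measurable_id
  have h := indep_iSup_of_disjoint (fun n => (measurable_pi_apply n).comap_le) hind.iIndep
    (S := (s : Set ℤ)) (T := (s : Set ℤ)ᶜ) disjoint_compl_right
  have hle : ∀ (S : Set ℤ) (n : ℤ), n ∈ S → ∀ A : Set 𝕜, MeasurableSet A →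
      MeasurableSet[⨆ n ∈ S, MeasurableSpace.comap (fun y : ℤ → 𝕜 => y n) inferInstance]
        {y | y n ∈ A} := fun S n hn A hA =>
    le_iSup₂ (f := fun (n : ℤ) (_ : n ∈ S) =>
      MeasurableSpace.comap (fun y : ℤ → 𝕜 => y n) inferInstance) n hn _ ⟨A, hA, rfl⟩
  refine (Indep_iff _ _ _).1 h _ _ ?_ ?_
  · have : {y : ℤ → 𝕜 | ∀ n ∈ s, y n ∈ t n} = ⋂ n ∈ (s : Set ℤ), {y | y n ∈ t n} := by
      ext; simp
    rw [this]
    exact MeasurableSet.biInter (Set.to_countable _) fun n hn => hle _ n hn _ (ht n)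
  · have : {y : ℤ → 𝕜 | ∀ n ∉ s, y n ∈ t' n} = ⋂ n ∈ (s : Set ℤ)ᶜ, {y | y n ∈ t' n} := by
      ext; simp
    rw [this]
    exact MeasurableSet.biInter (Set.to_countable _) fun n hn => hle _ n hn _ (ht' n)

theorem exists_forall_le_measure_tail_pos (hm : ∑' n, m {z | R n < ‖z‖} ≠ ⊤) :
    ∃ s₀ : Finset ℤ, ∀ s, s₀ ≤ s →
      (Measure.infinitePi fun _ : ℤ => m) {y | ∀ n ∉ s, y n ∈ {z | ‖z‖ ≤ R n}} ≠ 0 := by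
  have h := (ENNReal.tendsto_tsum_compl_atTop_zero hm).eventually (gt_mem_nhds zero_lt_one)
  obtain ⟨s₀, hs₀⟩ := eventually_atTop.1 h
  refine ⟨s₀, fun s hs hcon => ?_⟩
  set ν := Measure.infinitePi fun _ : ℤ => m
  have heq : ∀ n, ν {y | R n < ‖y n‖} = m {z | R n < ‖z‖} :=
    fun n => (measurePreserving_eval_infinitePi (fun _ : ℤ => m) n).measure_preimage
      (measurableSet_lt measurable_const measurable_norm).nullMeasurableSet
  have h1 : ν {y | ∀ n ∉ s, y n ∈ {z | ‖z‖ ≤ R n}}ᶜ < 1 := by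
    refine lt_of_le_of_lt ?_ (hs₀ s hs)
    calc ν {y | ∀ n ∉ s, y n ∈ {z | ‖z‖ ≤ R n}}ᶜ
        ≤ ν (⋃ n : {n // n ∉ s}, {y | R n < ‖y n‖}) := by
          refine measure_mono fun y hy => ?_
          simpa using hy
      _ ≤ ∑' n : {n // n ∉ s}, ν {y | R n < ‖y n‖} := measure_iUnion_le _
      _ = _ := by simp_rw [heq]
  have h2 : (1 : ENNReal) ≤ 0 + ν {y | ∀ n ∉ s, y n ∈ {z | ‖z‖ ≤ R n}}ᶜ := by
    rw [← hcon, ← measure_univ (μ := ν), ← Set.union_compl_self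
      {y : ℤ → 𝕜 | ∀ n ∉ s, y n ∈ {z | ‖z‖ ≤ R n}}]
    exact measure_union_le _ _
  rw [zero_add] at h2
  exact absurd h1 (not_lt.2 h2)

/-- Pick `x = ∑ c n • u n` in `U` with `c` finitely supported. Coefficients near `c` on a large
finite `s`, and bounded by `R` off `s`, are independent events of positive probability; together
they put the sum in `U`. -/
theorem HasBoundedMultipliers.measure_tsum_mem_ne_zero [ContinuousSMul 𝕜 E] [CompleteSpace E]
    [T2Space E] [m.IsOpenPosMeasure]
    (hbm : HasBoundedMultipliers ℤ 𝕜 E) (hR : ∀ n, 0 ≤ R n)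
    (hs : Summable fun n => (R n : 𝕜) • u n) (hm : ∑' n, m {z | R n < ‖z‖} ≠ ⊤)
    (hdense : Dense (Submodule.span 𝕜 (Set.range u) : Set E))
    {U : Set E} (hU : IsOpen U) (hne : U.Nonempty) :
    (Measure.infinitePi fun _ : ℤ => m) {y | ∑' n, y n • u n ∈ U} ≠ 0 := by
  classical
  obtain ⟨x, hxU, hx⟩ := hdense.inter_open_nonempty U hU hne
  obtain ⟨c, hc⟩ := Finsupp.mem_span_range_iff_exists_finsupp.1 hx
  have hU0 : (fun z => x + z) ⁻¹' U ∈ 𝓝 (0 : E) :=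
    (continuous_const_add x).continuousAt.preimage_mem_nhds (by simpa using hU.mem_nhds hxU)
  obtain ⟨W, hW, hWU⟩ := exists_nhds_zero_half hU0
  -- A closed `W'` retains the infinite tail as a limit of finite sums.
  obtain ⟨W', ⟨hW', hW'c⟩, hW'W⟩ := (closed_nhds_basis (0 : E)).mem_iff.1 hW
  obtain ⟨s₁, hs₁⟩ := hbm.exists_finset_forall_sum_mem hR hs hW'
  obtain ⟨s₂, hs₂⟩ := exists_forall_le_measure_tail_pos hm
  set s := s₁ ∪ s₂ ∪ c.support with hsdef
  have hss₁ : s₁ ⊆ s := Finset.subset_union_left.trans Finset.subset_union_left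
  have hss₂ : s₂ ⊆ s := Finset.subset_union_right.trans Finset.subset_union_left
  have hsc : c.support ⊆ s := Finset.subset_union_right
  -- the head of the series
  set H : Set (ℤ → 𝕜) := {y | ∑ n ∈ s, y n • u n - x ∈ interior W} with hH
  have hHo : IsOpen H := by
    have : Continuous fun y : ℤ → 𝕜 => ∑ n ∈ s, y n • u n - x := by fun_prop
    exact isOpen_interior.preimage this
  have hcH : (c : ℤ → 𝕜) ∈ H := by
    have : ∑ n ∈ s, c n • u n = x := by
      rw [← hc, Finsupp.sum_of_support_subset c hsc _ (by simp)]
    simp only [hH, Set.mem_ofPred_eq, this, sub_self]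
    exact mem_interior_iff_mem_nhds.2 hW
  obtain ⟨I, t, htI, hItH⟩ := isOpen_pi_iff.1 hHo c hcH
  let t' : ℤ → Set 𝕜 := fun n => if n ∈ I then t n else Set.univ
  have ht'o : ∀ n, IsOpen (t' n) := by
    intro n
    by_cases hn : n ∈ I
    · simpa [t', hn] using (htI n hn).1
    · simp [t', hn]
  have hct' : ∀ n, c n ∈ t' n := by
    intro n
    by_cases hn : n ∈ I
    · simpa [t', hn] using (htI n hn).2
    · simp [t', hn]
  have hBH : ∀ y : ℤ → 𝕜, (∀ n ∈ s, y n ∈ t' n) → y ∈ H := by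
    intro y hy
    -- The box found inside `H` may constrain coordinates outside `s`; membership in `H` ignores
    -- these, so they can be reset to `c`.
    have h1 : (fun n => if n ∈ s then y n else c n) ∈ H := by
      refine hItH fun n hn => ?_
      have hn' : n ∈ I := hn
      by_cases hns : n ∈ s
      · simpa [t', hn', hns] using hy n hns
      · simpa [t', hn', hns] using hct' n
    have h2 : ∑ n ∈ s, (if n ∈ s then y n else c n) • u n = ∑ n ∈ s, y n • u n :=
      Finset.sum_congr rfl fun n hn => by rw [if_pos hn]
    simpa only [hH, Set.mem_ofPred_eq, h2] using h1
  have hB : (Measure.infinitePi fun _ : ℤ => m) {y | ∀ n ∈ s, y n ∈ t' n} ≠ 0 := by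
    have := Measure.infinitePi_pi (fun _ : ℤ => m) (s := s) (t := t')
      fun n _ => (ht'o n).measurableSet
    change (Measure.infinitePi fun _ : ℤ => m) {y | ∀ n ∈ s, y n ∈ t' n} = _ at this
    rw [this, Finset.prod_ne_zero_iff]
    exact fun n _ => (ht'o n).measure_ne_zero m ⟨c n, hct' n⟩
  have hBK := indep_box_tail (m := m) (s := s) (fun n => (ht'o n).measurableSet)
    (t' := fun n => {z | ‖z‖ ≤ R n}) fun n => measurableSet_le measurable_norm measurable_const
  have hpos := mul_ne_zero hB (hs₂ s hss₂)
  rw [← hBK] at hpos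
  refine fun hcon => hpos (measure_mono_null_ae ?_ hcon)
  filter_upwards [hbm.ae_summable hR hs hm] with y hy hyBK
  have hhead := interior_subset (hBH y hyBK.1)
  have htail : ∑' n, y n • u n - ∑ n ∈ s, y n • u n ∈ W' := by
    refine hW'c.mem_of_tendsto (hy.hasSum.sub_const _) ?_
    filter_upwards [eventually_ge_atTop s] with t hst
    rw [← Finset.sum_sdiff hst, add_sub_cancel_right]
    refine hs₁ y _ (Finset.sdiff_disjoint.mono_right hss₁) fun n hn => ?_
    exact hyBK.2 n (Finset.mem_sdiff.1 hn).2
  have := hWU _ hhead _ (hW'W htail)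
  change x + _ ∈ U at this
  change ∑' n, y n • u n ∈ U
  convert this using 1
  abel

/-- The random series `∑ Y n • u n` with independent, identically distributed coefficients of full
support and sufficiently small tails is frequently hypercyclic for an operator that shifts `u`. -/
theorem HasBoundedMultipliers.inducesMixingFHC [ContinuousSMul 𝕜 E] [CompleteSpace E] [MeasurableSpace E] [BorelSpace E]
    [TopologicalSpace.MetrizableSpace E] (hbm : HasBoundedMultipliers ℤ 𝕜 E) {T : E →L[𝕜] E}
    (hT : ∀ n, T (u n) = u (n - 1))
    (hdense : Dense (Submodule.span 𝕜 (Set.range u) : Set E)) (hR : ∀ n, 0 ≤ R n)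
    (hs : Summable fun n => (R n : 𝕜) • u n)
    {Ω₀ : Type*} [MeasurableSpace Ω₀] {P₀ : Measure Ω₀} [IsProbabilityMeasure P₀] {X : Ω₀ → 𝕜}
    (hX : HasFullSupport X P₀) (htail : ∑' n, P₀ {ω | R n < ‖X ω‖} ≠ ⊤)
    {Ω : Type*} [MeasurableSpace Ω] {P : Measure Ω} [IsProbabilityMeasure P]
    {Y : ℤ → Ω → 𝕜} (hY : IsIIDCopies Y P X P₀) : InducesMixingFHC T u Y P := by
  have : SecondCountableTopology E := secondCountableTopology_of_dense_span hdense
  obtain ⟨hXm, hXs⟩ := hX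
  set m := P₀.map X with hmdef
  have : IsProbabilityMeasure m := Measure.isProbabilityMeasure_map hXm
  have hm : ∑' n, m {z | R n < ‖z‖} ≠ ⊤ := by
    have : ∀ n, m {z | R n < ‖z‖} = P₀ {ω | R n < ‖X ω‖} := fun n =>
      Measure.map_apply_of_aemeasurable hXm (measurableSet_lt measurable_const measurable_norm)
    simpa only [this] using htail
  set ν := Measure.infinitePi fun _ : ℤ => m with hν
  have hYm : ∀ n, AEMeasurable (Y n) P := fun n => (hY.2 n).aemeasurable_fst
  have hYm' : AEMeasurable (fun ω n => Y n ω) P := aemeasurable_pi_iff.2 hYm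
  -- All claims depend only on the joint law of the coefficients, so they can be proved on the
  -- product space.
  have hlaw : P.map (fun ω n => Y n ω) = ν := by
    rw [hY.1.map_fun_eq_infinitePi_map₀' hYm]
    simp_rw [fun n => (hY.2 n).map_eq]
    rfl
  set Φ : (ℤ → 𝕜) → E := fun y => ∑' n, y n • u n with hΦdef
  have hsum : ∀ᵐ y ∂ν, Summable fun n => y n • u n := hbm.ae_summable hR hs hm
  have hΦ : AEMeasurable Φ ν := aemeasurable_tsum_smul hsum
  have hΦ' : AEMeasurable Φ (P.map fun ω n => Y n ω) := by rwa [hlaw]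
  have hv : AEMeasurable (fun ω => ∑' n, Y n ω • u n) P := hΦ'.comp_aemeasurable hYm'
  have hvlaw : P.map (fun ω => ∑' n, Y n ω • u n) = ν.map Φ := by
    rw [← hlaw, AEMeasurable.map_map_of_aemeasurable hΦ' hYm']
    rfl
  have hmix : IsStronglyMixing T (ν.map Φ) :=
    (isStronglyMixing_leftShift m).of_semiconj hΦ T.continuous.measurable
      (hsum.mono fun y hy => tsum_leftShift_smul hT hy)
  have hpos : (ν.map Φ).IsOpenPosMeasure := by
    refine ⟨fun U hU hne => ?_⟩
    rw [Measure.map_apply_of_aemeasurable hΦ hU.measurableSet]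
    exact hbm.measure_tsum_mem_ne_zero hR hs hm hdense hU hne
  have : IsProbabilityMeasure (ν.map Φ) := Measure.isProbabilityMeasure_map hΦ
  have hfhc := hmix.ae_isFrequentlyHypercyclic
  refine ⟨?_, hv, ?_, ?_, hv, ?_⟩
  · rw [← hlaw] at hsum
    exact ae_of_ae_map hYm' hsum
  · rw [← hvlaw] at hfhc
    exact ae_of_ae_map hv hfhc
  · rwa [hvlaw]
  · rwa [hvlaw]

end Series

/-! ### Gaussian variables -/

section Gaussian

variable {Ω : Type*} [MeasurableSpace Ω] {P : Measure Ω}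

theorem ProbabilityTheory.HasGaussianLaw.isOpenPosMeasure_map {Z : Ω → ℝ}
    (hZ : HasGaussianLaw Z P) (hc : ¬ ∃ a : ℝ, ∀ᵐ ω ∂P, Z ω = a) :
    (P.map Z).IsOpenPosMeasure := by
  rw [hZ.map_eq_gaussianReal]
  refine (gaussianReal_absolutelyContinuous' _ fun hv => hc ?_).isOpenPosMeasure
  have h := hZ.map_eq_gaussianReal
  rw [hv, gaussianReal_zero_var] at h
  refine ⟨P[Z], ae_of_ae_map (p := fun z => z = P[Z]) hZ.aemeasurable ?_⟩
  rw [h]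
  exact (ae_dirac_iff (measurableSet_singleton _)).2 rfl

variable {𝕜 : Type*} [RCLike 𝕜] {X : Ω → 𝕜}

/-- Fernique's theorem gives an exponential square moment, and Markov's inequality gives the tail.
-/
theorem IsNonconstantGaussian.isSubgaussian (hX : IsNonconstantGaussian X P) :
    IsSubgaussian X P := by
  have hm := hX.1.aemeasurable
  have := hX.1.isGaussian_map
  have := hX.1.isProbabilityMeasure
  obtain ⟨c, hc, hint⟩ := IsGaussian.exists_integrable_exp_sq (P.map X)
  have hint' : Integrable (fun ω => Real.exp (c * ‖X ω‖ ^ 2)) P := hint.comp_aemeasurable hm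
  refine ⟨hm, ∫ ω, Real.exp (c * ‖X ω‖ ^ 2) ∂P, c, integral_exp_pos hint', hc, fun t ht => ?_⟩
  have h := mul_meas_ge_le_integral_of_nonneg (μ := P)
    (Eventually.of_forall fun ω => (Real.exp_pos (c * ‖X ω‖ ^ 2)).le) hint' (Real.exp (c * t ^ 2))
  have hset : {ω | Real.exp (c * t ^ 2) ≤ Real.exp (c * ‖X ω‖ ^ 2)} = {ω | t ≤ ‖X ω‖} := by
    ext ω
    simp only [Set.mem_ofPred_eq]
    rw [Real.exp_le_exp, mul_le_mul_iff_right₀ hc, pow_le_pow_iff_left₀ ht (norm_nonneg _) two_ne_zero]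
  rw [hset] at h
  rw [neg_mul, Real.exp_neg, ← div_eq_mul_inv, le_div_iff₀ (Real.exp_pos _), mul_comm]
  exact h

/-- In the complex case, subtract from `Im X` its linear regression on `Re X`. The residual is
uncorrelated with `Re X`, hence independent of it by joint Gaussianity, and neither is constant.
Their product law has full support, and `X` is its image under a continuous surjection. -/
theorem IsNonconstantGaussian.hasFullSupport (hX : IsNonconstantGaussian X P) :
    HasFullSupport X P := by
  obtain ⟨hG, hL⟩ := hX
  have hm := hG.aemeasurable
  have := hG.isProbabilityMeasure
  refine ⟨hm, ?_⟩
  set A : Ω → ℝ := fun ω => RCLike.re (X ω) with hA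
  have hAG : HasGaussianLaw A P := hG.map_fun RCLike.reCLM
  have hAc : ¬ ∃ a : ℝ, ∀ᵐ ω ∂P, A ω = a := by
    refine hL RCLike.reCLM fun h => ?_
    have := congrArg (fun L : 𝕜 →L[ℝ] ℝ => L 1) h
    simp at this
  have hAs := hAG.isOpenPosMeasure_map hAc
  rcases RCLike.I_eq_zero_or_im_I_eq_one (K := 𝕜) with hI | hI
  · have hXA : X = (fun r : ℝ => (r : 𝕜)) ∘ A := by
      funext ω
      have := RCLike.re_add_im (X ω)
      rw [hI, mul_zero, add_zero] at this
      exact this.symm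
    rw [hXA, ← AEMeasurable.map_map_of_aemeasurable
      RCLike.continuous_ofReal.measurable.aemeasurable hAG.aemeasurable]
    refine RCLike.continuous_ofReal.isOpenPosMeasure_map fun z => ⟨RCLike.re z, ?_⟩
    have := RCLike.re_add_im z
    rwa [hI, mul_zero, add_zero] at this
  · set c : ℝ := cov[A, fun ω => RCLike.im (X ω); P] / Var[A; P] with hcdef
    set B : Ω → ℝ := fun ω => RCLike.im (X ω) - c * A ω with hB
    let LB : 𝕜 →L[ℝ] ℝ := RCLike.imCLM - c • RCLike.reCLM
    have hLB : ∀ ω, LB (X ω) = B ω := fun ω => rfl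
    have hpair : HasGaussianLaw (fun ω => (A ω, B ω)) P :=
      hG.map_fun (RCLike.reCLM.prod LB)
    have hBG : HasGaussianLaw B P := hG.map_fun LB
    have hIG : HasGaussianLaw (fun ω => RCLike.im (X ω)) P := hG.map_fun RCLike.imCLM
    have hBc : ¬ ∃ a : ℝ, ∀ᵐ ω ∂P, B ω = a := by
      refine hL LB fun h => ?_
      have := congrArg (fun L : 𝕜 →L[ℝ] ℝ => L RCLike.I) h
      simp [LB, hI] at this
    have hVar : Var[A; P] ≠ 0 := by
      intro h0
      have h := hAG.map_eq_gaussianReal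
      rw [h0, Real.toNNReal_zero, gaussianReal_zero_var] at h
      refine hAc ⟨P[A], ae_of_ae_map (p := fun z => z = P[A]) hAG.aemeasurable ?_⟩
      rw [h]
      exact (ae_dirac_iff (measurableSet_singleton _)).2 rfl
    have hcov : cov[A, B; P] = 0 := by
      have h1 : cov[A, B; P] = cov[A, fun ω => RCLike.im (X ω); P] - cov[A, fun ω => c * A ω; P] :=
        covariance_fun_sub_right hAG.memLp_two hIG.memLp_two (hAG.memLp_two.const_mul c)
      rw [h1, covariance_const_mul_right, covariance_self hAG.aemeasurable, hcdef,
        div_mul_cancel₀ _ hVar, sub_self]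
    have hind := hpair.indepFun_of_covariance_eq_zero hcov
    have hBs := hBG.isOpenPosMeasure_map hBc
    have hprod := (indepFun_iff_map_prod_eq_prod_map_map hAG.aemeasurable hBG.aemeasurable).1 hind
    let g : ℝ × ℝ → 𝕜 := fun p => (p.1 : 𝕜) + ((p.2 + c * p.1 : ℝ) : 𝕜) * RCLike.I
    have hg : Continuous g := by
      have h1 : Continuous fun p : ℝ × ℝ => (p.1 : 𝕜) :=
        RCLike.continuous_ofReal.comp continuous_fst
      have h2 : Continuous fun p : ℝ × ℝ => ((p.2 + c * p.1 : ℝ) : 𝕜) :=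
        RCLike.continuous_ofReal.comp (by fun_prop)
      exact h1.add (h2.mul continuous_const)
    have hXg : X = g ∘ fun ω => (A ω, B ω) := by
      funext ω
      have := RCLike.re_add_im (X ω)
      simp [g, hA, hB, this]
    rw [hXg, ← AEMeasurable.map_map_of_aemeasurable hg.measurable.aemeasurable hpair.aemeasurable,
      hprod]
    have := Measure.isProbabilityMeasure_map hAG.aemeasurable
    have := Measure.isProbabilityMeasure_map hBG.aemeasurable
    refine hg.isOpenPosMeasure_map fun z => ⟨(RCLike.re z, RCLike.im z - c * RCLike.re z), ?_⟩
    simp [g, RCLike.re_add_im]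

end Gaussian

/-! ### Weighted shifts -/

section Beta

variable {𝕜 : Type*} [RCLike 𝕜] {w : ℤ → 𝕜}

theorem bilateralBeta_ne_zero (hw : ∀ n, w n ≠ 0) (n : ℤ) : bilateralBeta w n ≠ 0 := by
  unfold bilateralBeta
  split_ifs
  · exact Finset.prod_ne_zero_iff.2 fun k _ => hw k
  · exact inv_ne_zero (Finset.prod_ne_zero_iff.2 fun k _ => hw k)

theorem bilateralBeta_eq_mul (hw : ∀ n, w n ≠ 0) (n : ℤ) :
    bilateralBeta w n = w n * bilateralBeta w (n - 1) := by
  unfold bilateralBeta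
  have h2 : ∀ n : ℤ, n ≤ 0 →
      ∏ k ∈ Finset.Icc (n - 1 + 1) 0, w k = w n * ∏ k ∈ Finset.Icc (n + 1) 0, w k := by
    intro n hn
    have : Finset.Icc (n - 1 + 1) 0 = insert n (Finset.Icc (n + 1) 0) := by
      ext k; simp only [Finset.mem_Icc, Finset.mem_insert]; omega
    rw [this, Finset.prod_insert (by simp)]
  rcases lt_trichotomy n 0 with hn | rfl | hn
  · rw [if_neg (by omega), if_neg (by omega), h2 n hn.le, mul_inv, ← mul_assoc,
      mul_inv_cancel₀ (hw n), one_mul]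
  · rw [if_pos le_rfl, if_neg (by omega), h2 0 le_rfl]
    simp [hw 0]
  · have : Finset.Icc 1 n = insert n (Finset.Icc 1 (n - 1)) := by
      ext k; simp only [Finset.mem_Icc, Finset.mem_insert]; omega
    rw [if_pos hn.le, if_pos (by omega), this, Finset.prod_insert (by simp)]

/-- Rescaling by `β` removes the weights. -/
theorem map_inv_bilateralBeta_smul {E : Type*} [AddCommGroup E] [Module 𝕜 E] {T : E →ₗ[𝕜] E}
    {e : ℤ → E} (hw : ∀ n, w n ≠ 0) (hT : ∀ n, T (e n) = w n • e (n - 1)) (n : ℤ) :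
    T ((bilateralBeta w n)⁻¹ • e n) = (bilateralBeta w (n - 1))⁻¹ • e (n - 1) := by
  rw [map_smul, hT, smul_smul, bilateralBeta_eq_mul hw n, mul_inv, mul_comm (w n)⁻¹, mul_assoc,
    inv_mul_cancel₀ (hw n), mul_one]

theorem span_range_le_span_range_inv_smul {ι E : Type*} [AddCommGroup E] [Module 𝕜 E] {b : ι → 𝕜}
    (hb : ∀ n, b n ≠ 0) (e : ι → E) :
    Submodule.span 𝕜 (Set.range e) ≤ Submodule.span 𝕜 (Set.range fun n => (b n)⁻¹ • e n) := by
  rw [Submodule.span_le]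
  rintro _ ⟨n, rfl⟩
  have := Submodule.smul_mem _ (b n)
    (Submodule.subset_span (R := 𝕜) (Set.mem_range_self (f := fun n => (b n)⁻¹ • e n) n))
  rwa [smul_smul, mul_inv_cancel₀ (hb n), one_smul] at this

end Beta

/-! ### Coefficient laws with summable tails, and the main theorem -/

/-- There is a random variable of full support whose tails are summable along a given sequence
tending to infinity. -/
theorem exists_hasFullSupport_tsum_tail_ne_top (𝕜 : Type*) [RCLike 𝕜] {R : ℤ → ℝ}
    (hR : Tendsto R cofinite atTop) :
    ∃ (Ω₀ : Type) (_ : MeasurableSpace Ω₀) (P₀ : Measure Ω₀) (_ : IsProbabilityMeasure P₀)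
      (X : Ω₀ → 𝕜), Measurable X ∧ HasFullSupport X P₀ ∧ ∑' n, P₀ {ω | R n < ‖X ω‖} ≠ ⊤ := by
  let d : ℕ → 𝕜 := TopologicalSpace.denseSeq 𝕜
  have hfin : ∀ k, {n | R n < ‖d k‖}.Finite := fun k => by
    have := hR.eventually (eventually_ge_atTop ‖d k‖)
    rw [eventually_cofinite] at this
    simpa using this
  -- The value `d k` contributes its mass once for each `n` with `R n < ‖d k‖`; dividing by this
  -- finite count makes the total geometric. The `+ 1` avoids division by zero and bounds `q k` by
  -- `2⁻¹ ^ (k + 1)`.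
  let q : ℕ → ENNReal := fun k => (2⁻¹) ^ (k + 1) / ({n | R n < ‖d k‖}.encard + 1 : ℕ∞)
  have hcount : ∀ k, (({n | R n < ‖d k‖}.encard + 1 : ℕ∞) : ENNReal) ≠ ⊤ := fun k => by
    simpa using hfin k
  have hq0 : ∀ k, q k ≠ 0 := fun k => by
    refine (ENNReal.div_pos (pow_ne_zero _ (by simp)) (hcount k)).ne'
  have hqN : ∀ k, ({n | R n < ‖d k‖}.encard : ENNReal) * q k ≤ (2⁻¹) ^ (k + 1) := fun k => by
    rw [mul_comm]
    refine (mul_le_mul_right ?_ _).trans (ENNReal.div_mul_cancel (by simp) (hcount k)).le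
    exact_mod_cast le_self_add
  have hgeom : ∑' k : ℕ, ((2 : ENNReal)⁻¹) ^ (k + 1) = 1 := by
    rw [ENNReal.tsum_geometric_add_one, ENNReal.one_sub_inv_two, inv_inv,
      ENNReal.inv_mul_cancel two_ne_zero ENNReal.ofNat_ne_top]
  have hqs : ∑' k, q k ≠ ⊤ := by
    refine ne_top_of_le_ne_top ENNReal.one_ne_top (hgeom ▸ ENNReal.tsum_le_tsum fun k => ?_)
    refine ENNReal.div_le_of_le_mul (le_mul_of_one_le_right' ?_)
    exact_mod_cast le_add_self
  have hqs0 : ∑' k, q k ≠ 0 := fun h => hq0 0 (ENNReal.tsum_eq_zero.1 h 0)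
  let p : PMF ℕ := PMF.normalize q hqs0 hqs
  have hp : ∀ k, p k = q k * (∑' j, q j)⁻¹ := fun k => PMF.normalize_apply hqs0 hqs k
  have hdm : Measurable d := measurable_from_top
  refine ⟨ℕ, inferInstance, p.toMeasure, inferInstance, d, hdm, ⟨hdm.aemeasurable, ⟨?_⟩⟩, ?_⟩
  · intro U hU hne
    obtain ⟨k, hk⟩ := (TopologicalSpace.denseRange_denseSeq 𝕜).exists_mem_open hU hne
    rw [Measure.map_apply hdm hU.measurableSet, Ne,
      PMF.toMeasure_apply_eq_zero_iff _ (hdm hU.measurableSet)]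
    intro hdisj
    refine Set.disjoint_left.1 hdisj (?_ : k ∈ p.support) hk
    rw [PMF.mem_support_iff, hp]
    exact mul_ne_zero (hq0 k) (ENNReal.inv_ne_zero.2 hqs)
  · have h1 : ∀ n, p.toMeasure {k | R n < ‖d k‖} = ∑' k, {k | R n < ‖d k‖}.indicator p k :=
      fun n => PMF.toMeasure_apply _ MeasurableSet.of_discrete
    simp_rw [h1]
    rw [ENNReal.tsum_comm]
    have h2 : ∀ k, ∑' n, {k | R n < ‖d k‖}.indicator p k
        ≤ (2⁻¹) ^ (k + 1) * (∑' j, q j)⁻¹ := by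
      intro k
      have : ∀ n, {k | R n < ‖d k‖}.indicator p k = {n | R n < ‖d k‖}.indicator (fun _ => p k) n :=
        fun n => by simp [Set.indicator_apply]
      simp_rw [this]
      rw [← tsum_subtype, ENNReal.tsum_const, ENat.card_coe_set_eq, hp, ← mul_assoc]
      exact mul_le_mul_left (hqN k) _
    refine ne_top_of_le_ne_top ?_ (ENNReal.tsum_le_tsum h2)
    rw [ENNReal.tsum_mul_right, hgeom, one_mul]
    exact ENNReal.inv_ne_top.2 hqs0

/-- With `M ^ 2 = 2 / c`, the subgaussian bound at `M √(log |n|)` is `C / n ^ 2` for `n ≠ 0`. -/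
theorem IsSubgaussian.exists_tsum_tail_ne_top {Ω 𝕜 : Type*} [RCLike 𝕜] [MeasurableSpace Ω]
    {X : Ω → 𝕜} {P : Measure Ω} [IsProbabilityMeasure P] (hX : IsSubgaussian X P) :
    ∃ M : ℝ, 0 ≤ M ∧ ∑' n : ℤ, P {ω | M * √(Real.log |(n : ℝ)|) < ‖X ω‖} ≠ ⊤ := by
  obtain ⟨-, C, c, hC, hc, h⟩ := hX
  refine ⟨√(2 / c), Real.sqrt_nonneg _, ?_⟩
  have hlog : ∀ n : ℤ, 0 ≤ Real.log |(n : ℝ)| := by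
    intro n
    rw [← Int.cast_abs]
    exact Real.log_intCast_nonneg _
  have hbound : ∀ n : ℤ, P {ω | √(2 / c) * √(Real.log |(n : ℝ)|) < ‖X ω‖} ≤
      -- At `n = 0` the conventions `log 0 = 0` and `1 / 0 = 0` leave the bound `C`, supplied by the
      -- extra term.
      ENNReal.ofReal (C * (1 / (n : ℝ) ^ 2 + if n = 0 then 1 else 0)) := by
    intro n
    have h1 := h (√(2 / c) * √(Real.log |(n : ℝ)|)) (by positivity)
    have h2 : -c * (√(2 / c) * √(Real.log |(n : ℝ)|)) ^ 2 = -(2 * Real.log |(n : ℝ)|) := by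
      rw [mul_pow, Real.sq_sqrt (by positivity), Real.sq_sqrt (hlog n)]
      field_simp
    rw [h2] at h1
    have h3 : Real.exp (-(2 * Real.log |(n : ℝ)|)) ≤
        1 / (n : ℝ) ^ 2 + if n = 0 then 1 else 0 := by
      rcases eq_or_ne n 0 with rfl | hn
      · simp
      · have hn' : 0 < |(n : ℝ)| := abs_pos.2 (by exact_mod_cast hn)
        rw [Real.exp_neg, two_mul, Real.exp_add, Real.exp_log hn', if_neg hn, abs_mul_abs_self]
        simp [sq]
    calc P {ω | √(2 / c) * √(Real.log |(n : ℝ)|) < ‖X ω‖}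
        ≤ P {ω | √(2 / c) * √(Real.log |(n : ℝ)|) ≤ ‖X ω‖} :=
          measure_mono fun ω hω => by
            simp only [Set.mem_ofPred_eq] at hω ⊢
            exact hω.le
      _ = ENNReal.ofReal (P.real {ω | √(2 / c) * √(Real.log |(n : ℝ)|) ≤ ‖X ω‖}) := by
          rw [ofReal_measureReal]
      _ ≤ _ := ENNReal.ofReal_le_ofReal (h1.trans (by gcongr))
  refine ne_top_of_le_ne_top ?_ (ENNReal.tsum_le_tsum hbound)
  refine Summable.tsum_ofReal_ne_top (Summable.mul_left _ (Summable.add ?_ ?_))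
  · exact Real.summable_one_div_int_pow.2 one_lt_two
  · exact (hasSum_ite_eq (0 : ℤ) (1 : ℝ)).summable

theorem summable_const_mul_sqrt_log_smul {𝕜 E : Type*} [RCLike 𝕜] [AddCommGroup E] [Module 𝕜 E]
    [TopologicalSpace E] [ContinuousConstSMul 𝕜 E] {b : ℤ → 𝕜} {e : ℤ → E}
    (h : Summable fun n : {n : ℤ // n ≠ 0} =>
      (((√(Real.log |((n : ℤ) : ℝ)|) : ℝ) : 𝕜) / b n) • e n) (M : ℝ) :
    Summable fun n : ℤ => ((M * √(Real.log |(n : ℝ)|) : ℝ) : 𝕜) • (b n)⁻¹ • e n := by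
  have h1 : Summable fun n : ℤ => (((√(Real.log |(n : ℝ)|) : ℝ) : 𝕜) / b n) • e n := by
    -- The term at `n = 0` vanishes since `Real.log 0 = 0`, so adding this index changes nothing.
    refine (Function.Injective.summable_iff Subtype.val_injective fun n hn => ?_).1 h
    have : n = 0 := by simpa using hn
    simp [this]
  refine (h1.const_smul (M : 𝕜)).congr fun n => ?_
  rw [smul_smul, smul_smul, RCLike.ofReal_mul, div_eq_mul_inv, mul_assoc]

/-- `E` is an F-sequence space over `ℤ`, realized through its coordinate map into `ℤ → 𝕜`, which is
linear, continuous and injective; `e n` are the canonical unit sequences. -/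
theorem mainTheorem3 {𝕜 : Type*} [RCLike 𝕜] {E : Type*} [AddCommGroup E] [Module 𝕜 E]
    [Module ℝ E] [IsScalarTower ℝ 𝕜 E]
    [UniformSpace E] [IsUniformAddGroup E] [ContinuousSMul 𝕜 E]
    [CompleteSpace E] [TopologicalSpace.MetrizableSpace E]
    [MeasurableSpace E] [BorelSpace E]
    (hE : IsLocallyBoundedTVS 𝕜 E ∨ LocallyConvexSpace ℝ E)
    (coord : E →L[𝕜] (ℤ → 𝕜)) (hcoord : Function.Injective coord)
    (e : ℤ → E) (he : ∀ n, coord (e n) = Pi.single n 1)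
    (hdense : Dense (Submodule.span 𝕜 (Set.range e) : Set E))
    (T : E →L[𝕜] E) (w : ℤ → 𝕜) (hw : ∀ n, w n ≠ 0) (hT : ∀ n, T (e n) = w n • e (n - 1)) :
    ((Summable fun n : ℤ => (bilateralBeta w n)⁻¹ • e n) →
      ∃ (Ω₀ : Type) (_ : MeasurableSpace Ω₀) (P₀ : Measure Ω₀) (_ : IsProbabilityMeasure P₀)
        (X : Ω₀ → 𝕜), Measurable X ∧ HasFullSupport X P₀ ∧
        ∀ (Ω : Type*) [MeasurableSpace Ω] (P : Measure Ω) [IsProbabilityMeasure P]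
          (Y : ℤ → Ω → 𝕜), IsIIDCopies Y P X P₀ →
          InducesMixingFHC T (fun n => (bilateralBeta w n)⁻¹ • e n) Y P) ∧
    ((Summable fun n : {n : ℤ // n ≠ 0} =>
        (((√(Real.log |((n : ℤ) : ℝ)|) : ℝ) : 𝕜) / bilateralBeta w n) • e n) →
      ∀ (Ω₀ : Type*) [MeasurableSpace Ω₀] (P₀ : Measure Ω₀) [IsProbabilityMeasure P₀]
        (X : Ω₀ → 𝕜),
        (IsSubgaussian X P₀ ∧ HasFullSupport X P₀) ∨ IsNonconstantGaussian X P₀ →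
        ∀ (Ω : Type*) [MeasurableSpace Ω] (P : Measure Ω) [IsProbabilityMeasure P]
          (Y : ℤ → Ω → 𝕜), IsIIDCopies Y P X P₀ →
          InducesMixingFHC T (fun n => (bilateralBeta w n)⁻¹ • e n) Y P) := by
  have hβ := bilateralBeta_ne_zero hw
  have hbm : HasBoundedMultipliers ℤ 𝕜 E :=
    hasBoundedMultipliers_of_locallyBounded_or_locallyConvex hE
  have hTu := map_inv_bilateralBeta_smul (T := (T : E →ₗ[𝕜] E)) hw hT
  have hdense' : Dense (Submodule.span 𝕜
      (Set.range fun n => (bilateralBeta w n)⁻¹ • e n) : Set E) :=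
    hdense.mono (span_range_le_span_range_inv_smul hβ e)
  refine ⟨fun hsum => ?_, fun hsum Ω₀ _ P₀ _ X hX Ω _ P _ Y hY => ?_⟩
  · obtain ⟨R, hR0, hR, hRs⟩ := hsum.exists_tendsto_atTop_smul (𝕜 := 𝕜)
    obtain ⟨Ω₀, mΩ₀, P₀, hP₀, X, hXm, hX, htail⟩ := exists_hasFullSupport_tsum_tail_ne_top 𝕜 hR
    exact ⟨Ω₀, mΩ₀, P₀, hP₀, X, hXm, hX, fun Ω _ P _ Y hY =>
      hbm.inducesMixingFHC hTu hdense' hR0 hRs hX htail hY⟩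
  · have hX' : IsSubgaussian X P₀ ∧ HasFullSupport X P₀ :=
      hX.elim id fun h => ⟨h.isSubgaussian, h.hasFullSupport⟩
    obtain ⟨M, hM, htail⟩ := hX'.1.exists_tsum_tail_ne_top
    exact hbm.inducesMixingFHC hTu hdense' (fun n => by positivity)
      (summable_const_mul_sqrt_log_smul hsum M) hX'.2 htail hY
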